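/- Let $C$ be an algebraically closed field of characteristic zero equipped with an archimedean absolute value $|\cdot|$ (for example $\mathbb{C}$ or $\overline{\mathbb{Q}}$ with the usual absolute value); archimedean means that the inequality $|x+y|\le\max(|x|,|y|)$ fails for some $x,y\in C$. Let $C(t)\subset C((t))$ be the field of rational functions, embedded by Laurent expansion at $0$, in the field of formal Laurent series. Let $C(\{t\})\subset C((t))$ be the field of convergent Laurent series, that is, of the series $\sum_{n\ge -N}a_nt^n$ such that $\sum_{n\ge 0}|a_n|r^n<\infty$ for some real $r>0$. Let $\tau:C((t))\to C((t))$ be the substitution $\tau(g)(t)=g\left(\frac{t}{1+t}\right)$. Let $f\in C(t)$, $f\neq 0$, and let $w\in C((t))\setminus C(t)$ satisfy $\tau(w)=w+f$. Then $w$ is differentially transcendental over $C(\{t\})$: for every integer $n\ge 0$ and every non-zero polynomial $P\in C(\{t\})[X_0,X_1,\dots,X_n]$ one has $$P\left(w,w',\dots,w^{(n)}\right)\neq 0,$$ where $'$ denotes the derivation $\frac{d}{dt}$ of $C((t))$. -/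

import Mathlib

open scoped LaurentSeries PowerSeries RatFunc

noncomputable section

namespace StrongDiffTranscendence

section Tau

variable (C : Type*) [Field C]

/-- The power series `t / (1 + t)`. -/
def tOverOneAddT : C⟦X⟧ := PowerSeries.X * (1 + PowerSeries.X)⁻¹

lemma hasSubst_tOverOneAddT : PowerSeries.HasSubst (tOverOneAddT C) :=
  PowerSeries.HasSubst.of_constantCoeff_zero' (by simp [tOverOneAddT])

lemma tOverOneAddT_ne_zero : tOverOneAddT C ≠ 0 := by
  unfold tOverOneAddT
  refine mul_ne_zero PowerSeries.X_ne_zero fun h => ?_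
  rw [PowerSeries.inv_eq_zero] at h
  simp at h

/-- Substitution `p(t) ↦ p(t / (1 + t))` on formal power series, with values in `C((t))`. -/
def tauPowerSeries : C⟦X⟧ →+* C⸨X⸩ :=
  (HahnSeries.ofPowerSeries ℤ C).comp
    (PowerSeries.substAlgHom (R := C) (hasSubst_tOverOneAddT C)).toRingHom

lemma isUnit_tauPowerSeries (y : Submonoid.powers (PowerSeries.X : C⟦X⟧)) :
    IsUnit (tauPowerSeries C y) := by
  obtain ⟨_, n, rfl⟩ := y
  have h : tauPowerSeries C PowerSeries.X =
      HahnSeries.ofPowerSeries ℤ C (tOverOneAddT C) := by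
    simp [tauPowerSeries, PowerSeries.substAlgHom_X (R := C) (hasSubst_tOverOneAddT C)]
  simp only [map_pow]
  refine IsUnit.pow n ?_
  rw [isUnit_iff_ne_zero, h]
  exact fun h0 => tOverOneAddT_ne_zero C
    (HahnSeries.ofPowerSeries_injective (h0.trans (map_zero _).symm))

/-- The substitution `τ : f(t) ↦ f(t / (1 + t))` on `C((t))`: the unique ring homomorphism
that extends the substitution on `C[[t]]`. -/
def tau : C⸨X⸩ →+* C⸨X⸩ :=
  IsLocalization.lift (M := Submonoid.powers (PowerSeries.X : C⟦X⟧))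
    (isUnit_tauPowerSeries C)

lemma tau_ofPowerSeries (p : C⟦X⟧) :
    tau C (HahnSeries.ofPowerSeries ℤ C p) =
      HahnSeries.ofPowerSeries ℤ C (p.subst (tOverOneAddT C)) := by
  have h : tau C (algebraMap C⟦X⟧ C⸨X⸩ p) = tauPowerSeries C p :=
    IsLocalization.lift_eq (isUnit_tauPowerSeries C) p
  rw [LaurentSeries.coe_algebraMap] at h
  rw [h]
  simp [tauPowerSeries, PowerSeries.coe_substAlgHom]

end Tau

section Convergent

variable {C : Type*} [NormedField C]

/-- A Laurent series `∑ aₙ tⁿ` converges (absolutely) on some punctured disc around `0`. -/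
def IsConvergent (f : C⸨X⸩) : Prop :=
  ∃ r : ℝ, 0 < r ∧ Summable fun n : ℕ => ‖f.coeff (n : ℤ)‖ * r ^ n

lemma summable_of_le {a : ℕ → C} {r s : ℝ} (hs : 0 ≤ s) (hsr : s ≤ r)
    (h : Summable fun n : ℕ => ‖a n‖ * r ^ n) : Summable fun n : ℕ => ‖a n‖ * s ^ n :=
  h.of_nonneg_of_le (fun n => by positivity)
    (fun n => mul_le_mul_of_nonneg_left (pow_le_pow_left₀ hs hsr n) (norm_nonneg _))

lemma IsConvergent.add {f g : C⸨X⸩} (hf : IsConvergent f) (hg : IsConvergent g) :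
    IsConvergent (f + g) := by
  obtain ⟨r, hr, hf⟩ := hf
  obtain ⟨s, hs, hg⟩ := hg
  have hm : 0 < min r s := lt_min hr hs
  refine ⟨min r s, hm, ((summable_of_le hm.le (min_le_left _ _) hf).add
    (summable_of_le hm.le (min_le_right _ _) hg)).of_nonneg_of_le
      (fun n => by positivity) fun n => ?_⟩
  rw [HahnSeries.coeff_add, ← add_mul]
  exact mul_le_mul_of_nonneg_right (norm_add_le _ _) (by positivity)

lemma IsConvergent.neg {f : C⸨X⸩} (hf : IsConvergent f) : IsConvergent (-f) := by
  simpa [IsConvergent] using hf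

lemma isConvergent_ofPowerSeries_iff (p : C⟦X⟧) :
    IsConvergent (HahnSeries.ofPowerSeries ℤ C p) ↔
      ∃ r : ℝ, 0 < r ∧ Summable fun n : ℕ => ‖PowerSeries.coeff n p‖ * r ^ n := by
  simp [IsConvergent]

lemma isConvergent_one : IsConvergent (1 : C⸨X⸩) := by
  refine ⟨1, one_pos, summable_of_ne_finset_zero (s := {0}) fun n hn => ?_⟩
  have : n ≠ 0 := by simpa using hn
  simp [HahnSeries.coeff_one, this]

lemma isConvergent_zero : IsConvergent (0 : C⸨X⸩) :=
  ⟨1, one_pos, by simp⟩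

lemma IsConvergent.single_mul {f : C⸨X⸩} (hf : IsConvergent f) (k : ℤ) :
    IsConvergent (HahnSeries.single k 1 * f) := by
  obtain ⟨r, hr, hf⟩ := hf
  refine ⟨r, hr, ?_⟩
  simp only [HahnSeries.coeff_single_mul, one_mul]
  obtain ⟨m, rfl | rfl⟩ := k.eq_nat_or_neg
  · rw [← summable_nat_add_iff m]
    refine (hf.mul_right (r ^ m)).congr fun n => ?_
    simp [pow_add, mul_assoc]
  · refine (((summable_nat_add_iff m).2 hf).mul_right ((r ^ m)⁻¹)).congr fun n => ?_
    have : r ^ m ≠ 0 := by positivity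
    simp only [sub_neg_eq_add, Nat.cast_add, pow_add]
    field_simp

lemma isConvergent_single_mul_iff (f : C⸨X⸩) (k : ℤ) :
    IsConvergent (HahnSeries.single k 1 * f) ↔ IsConvergent f := by
  refine ⟨fun h => ?_, fun h => h.single_mul k⟩
  have h' := h.single_mul (-k)
  rwa [← mul_assoc, HahnSeries.single_mul_single, neg_add_cancel, mul_one,
    HahnSeries.single_zero_one, one_mul] at h'

lemma isConvergent_powerSeriesPart_iff (f : C⸨X⸩) :
    IsConvergent (HahnSeries.ofPowerSeries ℤ C f.powerSeriesPart) ↔ IsConvergent f := by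
  rw [LaurentSeries.ofPowerSeries_powerSeriesPart, isConvergent_single_mul_iff]

lemma isConvergent_ofPowerSeries_mul {p q : C⟦X⟧}
    (hp : IsConvergent (HahnSeries.ofPowerSeries ℤ C p))
    (hq : IsConvergent (HahnSeries.ofPowerSeries ℤ C q)) :
    IsConvergent (HahnSeries.ofPowerSeries ℤ C (p * q)) := by
  rw [isConvergent_ofPowerSeries_iff] at *
  obtain ⟨r, hr, hf⟩ := hp
  obtain ⟨s, hs, hg⟩ := hq
  have hm : 0 < min r s := lt_min hr hs
  refine ⟨min r s, hm, ?_⟩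
  have hf' := summable_of_le hm.le (min_le_left _ _) hf
  have hg' := summable_of_le hm.le (min_le_right _ _) hg
  refine (summable_sum_mul_antidiagonal_of_summable_mul
    (Summable.mul_of_nonneg hf' hg' (fun _ => by positivity)
      (fun _ => by positivity))).of_nonneg_of_le (fun n => by positivity) fun n => ?_
  rw [PowerSeries.coeff_mul]
  refine (mul_le_mul_of_nonneg_right (norm_sum_le _ _) (by positivity)).trans ?_
  rw [Finset.sum_mul]
  refine Finset.sum_le_sum fun x hx => ?_
  rw [← Finset.HasAntidiagonal.mem_antidiagonal.1 hx, pow_add, norm_mul]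
  exact le_of_eq (by ring)

lemma IsConvergent.mul {f g : C⸨X⸩} (hf : IsConvergent f) (hg : IsConvergent g) :
    IsConvergent (f * g) := by
  rw [← f.single_order_mul_powerSeriesPart, ← g.single_order_mul_powerSeriesPart,
    mul_mul_mul_comm, HahnSeries.single_mul_single, mul_one, ← map_mul,
    isConvergent_single_mul_iff]
  exact isConvergent_ofPowerSeries_mul ((isConvergent_powerSeriesPart_iff f).2 hf)
    ((isConvergent_powerSeriesPart_iff g).2 hg)

lemma isConvergent_ofPowerSeries_inv {p : C⟦X⟧} (h0 : PowerSeries.constantCoeff p ≠ 0)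
    (hp : IsConvergent (HahnSeries.ofPowerSeries ℤ C p)) :
    IsConvergent (HahnSeries.ofPowerSeries ℤ C p⁻¹) := by
  rw [isConvergent_ofPowerSeries_iff] at *
  obtain ⟨r, hr, hp⟩ := hp
  set a : ℕ → C := fun n => PowerSeries.coeff n p with ha
  set c : C := PowerSeries.constantCoeff p with hc
  set S : ℝ := ∑' n, ‖a n‖ * r ^ n with hS
  have hS0 : 0 ≤ S := tsum_nonneg fun n => by positivity
  have hcpos : 0 < ‖c‖ := norm_pos_iff.2 h0
  set l : ℝ := ‖c‖ / (S + ‖c‖) with hl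
  have hden : 0 < S + ‖c‖ := by positivity
  have hl0 : 0 < l := by positivity
  have hl1 : l ≤ 1 := by rw [hl, div_le_one hden]; linarith
  have hlS : l * S ≤ ‖c‖ := by
    rw [hl, div_mul_eq_mul_div, div_le_iff₀ hden]
    nlinarith
  have hbound : ∀ n : ℕ, ‖PowerSeries.coeff n p⁻¹‖ * (l * r) ^ n ≤ ‖c‖⁻¹ := by
    intro n
    induction n using Nat.strong_induction_on with
    | _ n ih =>
      rw [PowerSeries.coeff_inv]
      split_ifs with hn
      · subst hn
        simp [hc]
      · rw [norm_mul, norm_neg, norm_inv, mul_assoc]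
        refine mul_le_of_le_one_right (by positivity) ?_
        have key : ‖∑ x ∈ Finset.HasAntidiagonal.antidiagonal n,
            if x.2 < n then PowerSeries.coeff x.1 p * PowerSeries.coeff x.2 p⁻¹ else 0‖ *
              (l * r) ^ n ≤ ∑ x ∈ Finset.HasAntidiagonal.antidiagonal n, (‖a x.1‖ * r ^ x.1) * (l * ‖c‖⁻¹) := by
          refine (mul_le_mul_of_nonneg_right (norm_sum_le _ _) (by positivity)).trans ?_
          rw [Finset.sum_mul]
          refine Finset.sum_le_sum fun x hx => ?_
          have hx' := Finset.HasAntidiagonal.mem_antidiagonal.1 hx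
          split_ifs with hlt
          · have h1 : 1 ≤ x.1 := by omega
            have h2 : l ^ x.1 ≤ l := by
              simpa using pow_le_pow_of_le_one hl0.le hl1 h1
            have h3 := ih x.2 hlt
            calc ‖PowerSeries.coeff x.1 p * PowerSeries.coeff x.2 p⁻¹‖ * (l * r) ^ n
                = (‖a x.1‖ * r ^ x.1) *
                  (l ^ x.1 * (‖PowerSeries.coeff x.2 p⁻¹‖ * (l * r) ^ x.2)) := by
                  rw [norm_mul, ← hx']; ring
              _ ≤ (‖a x.1‖ * r ^ x.1) * (l * ‖c‖⁻¹) := by gcongr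
          · rw [norm_zero, zero_mul]
            positivity
        refine key.trans ?_
        rw [← Finset.sum_mul]
        have hsum : ∑ x ∈ Finset.HasAntidiagonal.antidiagonal n, ‖a x.1‖ * r ^ x.1 ≤ S := by
          rw [Finset.Nat.sum_antidiagonal_eq_sum_range_succ_mk]
          exact hp.sum_le_tsum _ fun n _ => by positivity
        calc (∑ x ∈ Finset.HasAntidiagonal.antidiagonal n, ‖a x.1‖ * r ^ x.1) * (l * ‖c‖⁻¹)
            ≤ S * (l * ‖c‖⁻¹) := by gcongr
          _ = (l * S) * ‖c‖⁻¹ := by ring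
          _ ≤ ‖c‖ * ‖c‖⁻¹ := by gcongr
          _ = 1 := mul_inv_cancel₀ hcpos.ne'
  refine ⟨l * r / 2, by positivity, (summable_geometric_two.mul_left ‖c‖⁻¹).of_nonneg_of_le
    (fun n => by positivity) fun n => ?_⟩
  calc ‖PowerSeries.coeff n p⁻¹‖ * (l * r / 2) ^ n
      = ‖PowerSeries.coeff n p⁻¹‖ * (l * r) ^ n * (1 / 2) ^ n := by
        rw [div_eq_mul_one_div (l * r), mul_pow, mul_assoc]
    _ ≤ ‖c‖⁻¹ * (1 / 2) ^ n := by
        gcongr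
        exact hbound n

lemma IsConvergent.inv {f : C⸨X⸩} (hf : IsConvergent f) : IsConvergent f⁻¹ := by
  by_cases h : f = 0
  · subst h
    simpa using isConvergent_zero
  have h0 : PowerSeries.constantCoeff f.powerSeriesPart ≠ 0 := by
    rw [← PowerSeries.coeff_zero_eq_constantCoeff_apply, LaurentSeries.powerSeriesPart_coeff]
    simpa using h
  have hinv : f⁻¹ = HahnSeries.single (-f.order) 1 *
      HahnSeries.ofPowerSeries ℤ C (f.powerSeriesPart)⁻¹ := by
    refine inv_eq_of_mul_eq_one_right ?_
    nth_rewrite 1 [← f.single_order_mul_powerSeriesPart]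
    rw [mul_mul_mul_comm, HahnSeries.single_mul_single, add_neg_cancel, mul_one, ← map_mul,
      PowerSeries.mul_inv_cancel _ h0, HahnSeries.single_zero_one, one_mul]
    exact map_one (HahnSeries.ofPowerSeries ℤ C)
  rw [hinv, isConvergent_single_mul_iff]
  exact isConvergent_ofPowerSeries_inv h0 ((isConvergent_powerSeriesPart_iff f).2 hf)

variable (C) in
/-- The field `C({t})` of convergent Laurent series, as a subfield of `C((t))`. -/
def convergentLaurent : Subfield C⸨X⸩ where
  carrier := {f | IsConvergent f}
  mul_mem' := IsConvergent.mul
  one_mem' := isConvergent_one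
  add_mem' := IsConvergent.add
  zero_mem' := isConvergent_zero
  neg_mem' := IsConvergent.neg
  inv_mem' _ := IsConvergent.inv

end Convergent

/-- Given a field `L` with a map `D : L → L` (a derivation), a subfield `K` of `L` and `w : L`:
no nonzero polynomial `P ∈ K[X₀, …, Xₙ]`, for any `n`, satisfies `P(w, D w, …, Dⁿ w) = 0`. -/
def IsDifferentiallyTranscendental {L : Type*} [Field L] (D : L → L) (K : Subfield L) (w : L) :
    Prop :=
  ∀ (n : ℕ) (P : MvPolynomial (Fin (n + 1)) K), P ≠ 0 →
    MvPolynomial.aeval (fun i : Fin (n + 1) => D^[(i : ℕ)] w) P ≠ 0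

end StrongDiffTranscendence

end

/-! The derivation θ = t² d/dt commutes with τ, so each θⁱw satisfies an equation of the same kind,
τ(θⁱw) = θⁱw + θⁱf, with θⁱf rational. Iterates of d/dt and of θ differ by an invertible triangular
matrix over C(t) ⊆ C({t}), so an algebraic relation over C({t}) among the derivatives of w yields
one among the θⁱw. An Ostrowski-type argument (`exists_linear_relation`) replaces it by a linear
one: Σ cᵢθⁱw + b is fixed by τ, with cᵢ, b ∈ C({t}) and the cᵢ fixed by τ and not all zero. The only
fixed elements of C((t)) are constants (`eq_C_of_tau_eq`), so some nontrivial Σ γᵢθⁱw with γᵢ ∈ C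
converges.

The formal Borel transform B turns θ into multiplication by z and τ into multiplication by exp(-z)
(`borel_theta`, `borel_tau`). It maps rational functions onto the exponential polynomials, and
convergent series to entire functions. Put L = Σ γᵢzⁱ and F = B(f). Then (exp(-z) - 1)B(w) = F, and
L·B(w) is entire, so LF vanishes at the points 2πin. Independence of the sequences q(n)ζⁿ removes L
and shows that F is exp(-z) - 1 times an exponential polynomial (`exists_eq_exp_sub_one_mul`). Hence
B(w) = B(r) with r rational. The kernel of B consists of polynomials in 1/t, so w is rational, a
contradiction.

Evaluation at 2πin takes place in ℂ. The archimedean hypothesis supplies an embedding of C into ℂ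
that controls absolute values (`exists_ringHom_complex`), through the theorems of Ostrowski and
Gelfand–Mazur. -/

noncomputable section

namespace StrongDiffTranscendence

/-! ### The derivation t² d/dt and its commutation with τ. -/

section Theta

variable {C : Type*} [Field C]

lemma coeff_derivative (f : C⸨X⸩) (n : ℤ) :
    (LaurentSeries.derivative C f).coeff n = (n + 1) * f.coeff (n + 1) := by
  simp

lemma derivative_ofPowerSeries (p : C⟦X⟧) :
    LaurentSeries.derivative C (HahnSeries.ofPowerSeries ℤ C p) =
      HahnSeries.ofPowerSeries ℤ C (PowerSeries.derivative C p) := by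
  ext n
  rw [coeff_derivative, PowerSeries.coeff_coe, PowerSeries.coeff_coe]
  rcases lt_trichotomy n (-1) with h | rfl | h
  · rw [if_pos (by omega), if_pos (by omega), mul_zero]
  · simp
  · obtain ⟨m, rfl⟩ := Int.eq_ofNat_of_zero_le (show 0 ≤ n by omega)
    rw [if_neg (by omega), if_neg (by omega), show ((m : ℤ) + 1).natAbs = m + 1 by omega,
      Int.natAbs_natCast, PowerSeries.coeff_derivative]
    push_cast
    ring

lemma derivative_single_mul (k : ℤ) (f : C⸨X⸩) :
    LaurentSeries.derivative C (HahnSeries.single k 1 * f) =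
      HahnSeries.single (k - 1) (k : C) * f +
        HahnSeries.single k 1 * LaurentSeries.derivative C f := by
  ext n
  rw [HahnSeries.coeff_add, coeff_derivative, HahnSeries.coeff_single_mul,
    HahnSeries.coeff_single_mul, HahnSeries.coeff_single_mul, coeff_derivative,
    show n - (k - 1) = n + 1 - k by ring, show n - k + 1 = n + 1 - k by ring]
  push_cast
  ring

/-- Factoring out powers of t reduces the Leibniz rule to that of power series. -/
lemma derivative_mul (f g : C⸨X⸩) :
    LaurentSeries.derivative C (f * g) =
      f * LaurentSeries.derivative C g + LaurentSeries.derivative C f * g := by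
  have key : ∀ (k : ℤ) (p q : C⟦X⟧), LaurentSeries.derivative C
      (HahnSeries.single k 1 * HahnSeries.ofPowerSeries ℤ C p * HahnSeries.ofPowerSeries ℤ C q) =
      HahnSeries.single k 1 * HahnSeries.ofPowerSeries ℤ C p *
        LaurentSeries.derivative C (HahnSeries.ofPowerSeries ℤ C q) +
      LaurentSeries.derivative C (HahnSeries.single k 1 * HahnSeries.ofPowerSeries ℤ C p) *
        HahnSeries.ofPowerSeries ℤ C q := by
    intro k p q
    rw [mul_assoc, ← map_mul, derivative_single_mul, derivative_single_mul,
      derivative_ofPowerSeries, derivative_ofPowerSeries, derivative_ofPowerSeries,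
      Derivation.leibniz]
    simp only [map_add, map_mul, smul_eq_mul]
    ring
  rw [← f.single_order_mul_powerSeriesPart, ← g.single_order_mul_powerSeriesPart]
  set p := HahnSeries.ofPowerSeries ℤ C f.powerSeriesPart
  set q := HahnSeries.ofPowerSeries ℤ C g.powerSeriesPart
  have e : HahnSeries.single f.order (1 : C) * p * (HahnSeries.single g.order 1 * q) =
      HahnSeries.single g.order 1 * (HahnSeries.single f.order 1 * p * q) := by ring
  rw [e, derivative_single_mul, key, derivative_single_mul g.order q]
  ring

variable (C) in
/-- The derivation `t² d/dt` of `C((t))`, which commutes with `τ`. -/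
def theta : C⸨X⸩ →ₗ[C] C⸨X⸩ where
  toFun g := HahnSeries.single 2 1 * LaurentSeries.derivative C g
  map_add' f g := by rw [map_add, mul_add]
  map_smul' c f := by
    rw [map_smul, RingHom.id_apply, ← HahnSeries.C_mul_eq_smul, ← HahnSeries.C_mul_eq_smul,
      mul_left_comm]

lemma theta_apply (g : C⸨X⸩) :
    theta C g = HahnSeries.single 2 1 * LaurentSeries.derivative C g := rfl

lemma coeff_theta (g : C⸨X⸩) (n : ℤ) : (theta C g).coeff n = (n - 1) * g.coeff (n - 1) := by
  rw [theta_apply, HahnSeries.coeff_single_mul, coeff_derivative,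
    show n - 2 + 1 = n - 1 by ring]
  push_cast
  ring

lemma theta_mul (f g : C⸨X⸩) : theta C (f * g) = f * theta C g + theta C f * g := by
  simp only [theta_apply, derivative_mul]
  ring

lemma theta_one : theta C 1 = 0 := by
  have := theta_mul (1 : C⸨X⸩) 1
  simpa using this

lemma theta_C (c : C) : theta C (HahnSeries.C c) = 0 := by
  ext n
  rw [coeff_theta, HahnSeries.C_apply]
  rcases eq_or_ne (n - 1) 0 with h | h
  · have : (n : C) - 1 = 0 := by exact_mod_cast congrArg (Int.cast (R := C)) h
    simp [this]
  · simp [HahnSeries.coeff_single_of_ne h]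

lemma tau_C (c : C) : tau C (HahnSeries.C c) = HahnSeries.C c := by
  rw [← HahnSeries.ofPowerSeries_C, tau_ofPowerSeries, ← PowerSeries.algebraMap_eq,
    ← PowerSeries.coe_substAlgHom (hasSubst_tOverOneAddT C), AlgHom.commutes]

lemma tau_single_one : tau C (HahnSeries.single 1 1) =
    HahnSeries.ofPowerSeries ℤ C (tOverOneAddT C) := by
  rw [← HahnSeries.ofPowerSeries_X, tau_ofPowerSeries,
    PowerSeries.subst_X (hasSubst_tOverOneAddT C)]

lemma tau_smul (c : C) (g : C⸨X⸩) : tau C (c • g) = c • tau C g := by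
  rw [← HahnSeries.C_mul_eq_smul, map_mul, tau_C, HahnSeries.C_mul_eq_smul]

lemma derivative_tOverOneAddT :
    PowerSeries.derivative C (tOverOneAddT C) = (1 + PowerSeries.X)⁻¹ ^ 2 := by
  have h : (1 + PowerSeries.X : C⟦X⟧) * (1 + PowerSeries.X)⁻¹ = 1 :=
    PowerSeries.mul_inv_cancel _ (by simp)
  rw [tOverOneAddT, Derivation.leibniz, PowerSeries.derivative_inv', map_add,
    PowerSeries.derivative_one, PowerSeries.derivative_X, smul_eq_mul, smul_eq_mul]
  linear_combination (-(1 + PowerSeries.X : C⟦X⟧)⁻¹) * h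

lemma theta_ofPowerSeries (p : C⟦X⟧) : theta C (HahnSeries.ofPowerSeries ℤ C p) =
    HahnSeries.ofPowerSeries ℤ C (PowerSeries.X ^ 2 * PowerSeries.derivative C p) := by
  rw [theta_apply, derivative_ofPowerSeries, map_mul, HahnSeries.ofPowerSeries_X_pow,
    Nat.cast_ofNat]

/-- With u = t/(1+t) one has t²u' = u², so t² d/dt is u² d/du and the chain rule gives the
commutation. -/
lemma theta_tau_ofPowerSeries (p : C⟦X⟧) :
    theta C (tau C (HahnSeries.ofPowerSeries ℤ C p)) =
      tau C (theta C (HahnSeries.ofPowerSeries ℤ C p)) := by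
  have hs := hasSubst_tOverOneAddT C
  have key : PowerSeries.X ^ 2 * PowerSeries.derivative C (p.subst (tOverOneAddT C)) =
      (PowerSeries.X ^ 2 * PowerSeries.derivative C p).subst (tOverOneAddT C) := by
    rw [PowerSeries.derivative_subst hs, derivative_tOverOneAddT, PowerSeries.subst_mul hs,
      PowerSeries.subst_pow hs, PowerSeries.subst_X hs]
    set q := (PowerSeries.derivative C p).subst (tOverOneAddT C)
    rw [tOverOneAddT, mul_pow]
    generalize (1 + PowerSeries.X : C⟦X⟧)⁻¹ = u
    ring
  have h1 := theta_ofPowerSeries (p.subst (tOverOneAddT C))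
  have h2 := tau_ofPowerSeries C (PowerSeries.X ^ 2 * PowerSeries.derivative C p)
  rw [tau_ofPowerSeries C p, h1, key, theta_ofPowerSeries p, h2]

/-- The elements on which the two maps agree are closed under products and inverses, and every
Laurent series is a quotient of power series. -/
lemma theta_tau (g : C⸨X⸩) : theta C (tau C g) = tau C (theta C g) := by
  have hmul : ∀ f g : C⸨X⸩, theta C (tau C f) = tau C (theta C f) →
      theta C (tau C g) = tau C (theta C g) →
      theta C (tau C (f * g)) = tau C (theta C (f * g)) := by
    intro f g hf hg
    rw [theta_mul, map_mul, theta_mul, hf, hg, map_add, map_mul, map_mul]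
  have hinv : ∀ f : C⸨X⸩, theta C (tau C f) = tau C (theta C f) →
      theta C (tau C f⁻¹) = tau C (theta C f⁻¹) := by
    intro f hf
    rcases eq_or_ne f 0 with rfl | h0
    · simp
    have h1 : f * f⁻¹ = 1 := mul_inv_cancel₀ h0
    have h2 := theta_mul f f⁻¹
    have h3 := theta_mul (tau C f) (tau C f⁻¹)
    rw [h1, theta_one] at h2
    rw [← map_mul, h1, map_one, theta_one] at h3
    have h4 := congrArg (tau C) h2
    rw [map_zero, map_add, map_mul, map_mul, ← hf, h3] at h4
    exact mul_left_cancel₀ ((map_ne_zero (tau C)).2 h0) (add_right_cancel h4)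
  obtain ⟨p, y, hp⟩ :=
    IsLocalization.exists_mk'_eq (Submonoid.powers (PowerSeries.X : C⟦X⟧)) g
  rw [IsLocalization.mk'_eq_iff_eq_mul, LaurentSeries.coe_algebraMap] at hp
  have hy : HahnSeries.ofPowerSeries ℤ C (y : C⟦X⟧) ≠ 0 := by
    obtain ⟨_, n, rfl⟩ := y
    simp
  rw [(eq_mul_inv_iff_mul_eq₀ hy).2 hp.symm]
  exact hmul _ _ (theta_tau_ofPowerSeries p) (hinv _ (theta_tau_ofPowerSeries _))

lemma theta_iterate_tau (g : C⸨X⸩) (n : ℕ) :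
    (theta C)^[n] (tau C g) = tau C ((theta C)^[n] g) := by
  induction n with
  | zero => rfl
  | succ n ih => rw [Function.iterate_succ_apply', Function.iterate_succ_apply', ih, theta_tau]

end Theta

/-! ### The formal Borel transform and the fixed field of τ. -/

section Borel

variable {C : Type*} [Field C] [CharZero C]

variable (C) in
/-- The formal Borel transform `∑ aₙ tⁿ ↦ ∑ aₙ₊₁ zⁿ / n!`; it kills the polynomials in `1/t`. -/
def borel : C⸨X⸩ →ₗ[C] C⟦X⟧ where
  toFun g := PowerSeries.mk fun n => g.coeff (n + 1) / (n.factorial : C)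
  map_add' f g := by ext n; simp [add_div]
  map_smul' c f := by ext n; simp [mul_div_assoc]

omit [CharZero C] in
lemma coeff_borel (g : C⸨X⸩) (n : ℕ) :
    PowerSeries.coeff n (borel C g) = g.coeff (n + 1) / (n.factorial : C) := by
  simp [borel]

lemma borel_theta (g : C⸨X⸩) : borel C (theta C g) = PowerSeries.X * borel C g := by
  ext n
  rw [coeff_borel, coeff_theta]
  cases n with
  | zero => simp
  | succ n =>
    rw [PowerSeries.coeff_succ_X_mul, coeff_borel, Nat.factorial_succ]
    have h1 : (n + 1 : C) ≠ 0 := by exact_mod_cast n.succ_ne_zero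
    have h2 : (n.factorial : C) ≠ 0 := by exact_mod_cast n.factorial_ne_zero
    push_cast
    simp only [add_sub_cancel_right]
    field_simp

lemma borel_theta_iterate (g : C⸨X⸩) (n : ℕ) :
    borel C ((theta C)^[n] g) = PowerSeries.X ^ n * borel C g := by
  induction n with
  | zero => simp
  | succ n ih => rw [Function.iterate_succ_apply', borel_theta, ih, pow_succ']; ring

lemma borel_eq_zero_iff (g : C⸨X⸩) : borel C g = 0 ↔ ∀ n : ℤ, 0 < n → g.coeff n = 0 := by
  constructor
  · intro h n hn
    obtain ⟨m, rfl⟩ : ∃ m : ℕ, n = m + 1 := ⟨(n - 1).toNat, by omega⟩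
    have := congrArg (PowerSeries.coeff m) h
    rw [coeff_borel, map_zero, div_eq_zero_iff] at this
    exact this.resolve_right (by exact_mod_cast m.factorial_ne_zero)
  · intro h
    ext n
    rw [coeff_borel, h _ (by omega)]
    simp

lemma exists_eq_single_add_theta (g : C⸨X⸩) :
    ∃ (c : C) (h : C⸨X⸩), g = c • HahnSeries.single 1 1 + theta C h := by
  -- θ reaches every coefficient except that of t, which the first summand carries. At n = 0 the
  -- quotient is 0 by convention, and θ ignores that coefficient.
  refine ⟨g.coeff 1, HahnSeries.ofSuppBddBelow (fun n => g.coeff (n + 1) / n)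
    ⟨g.order - 1, fun n hn => ?_⟩, ?_⟩
  · contrapose! hn
    rw [Function.notMem_support, HahnSeries.coeff_eq_zero_of_lt_order (by omega), zero_div]
  · ext n
    rw [HahnSeries.coeff_add, coeff_theta]
    simp only [HahnSeries.coeff_smul, HahnSeries.ofSuppBddBelow]
    rcases eq_or_ne n 1 with rfl | h
    · simp
    · have : (n : C) - 1 ≠ 0 := by exact_mod_cast sub_ne_zero.2 h
      rw [HahnSeries.coeff_single_of_ne h]
      push_cast
      field_simp
      simp

/-- The power series `exp(a z)`. -/
def expSeries (a : C) : C⟦X⟧ := PowerSeries.rescale a (PowerSeries.exp C)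

lemma coeff_expSeries (a : C) (n : ℕ) :
    PowerSeries.coeff n (expSeries a) = a ^ n / (n.factorial : C) := by
  simp [expSeries, PowerSeries.coeff_rescale, PowerSeries.coeff_exp, div_eq_mul_inv]

lemma expSeries_add (a b : C) : expSeries (a + b) = expSeries a * expSeries b :=
  (PowerSeries.exp_mul_exp_eq_exp_add a b).symm

lemma expSeries_zero : expSeries (0 : C) = 1 := by
  ext n
  cases n <;> simp [coeff_expSeries, PowerSeries.coeff_one]

/-- The discrepancy `err` between the two sides satisfies err(θg) = z·err(g) and err(t) = 0. Every
series is a multiple of t plus some θh, so `err g` is divisible by every power of z. -/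
lemma borel_tau (g : C⸨X⸩) : borel C (tau C g) = expSeries (-1) * borel C g := by
  set err : C⸨X⸩ → C⟦X⟧ := fun g => borel C (tau C g) - expSeries (-1) * borel C g with herr
  have h1 : ∀ g, err (theta C g) = PowerSeries.X * err g := by
    intro g
    simp only [herr, ← theta_tau, borel_theta]
    ring
  have h2 : err (HahnSeries.single 1 1) = 0 := by
    have hrec : ∀ n : ℕ, PowerSeries.coeff n (1 + PowerSeries.X : C⟦X⟧)⁻¹ = (-1) ^ n := by
      have h : (1 + PowerSeries.X : C⟦X⟧) * (1 + PowerSeries.X)⁻¹ = 1 :=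
        PowerSeries.mul_inv_cancel _ (by simp)
      intro n
      induction n with
      | zero => simp
      | succ n ih =>
        have := congrArg (PowerSeries.coeff (n + 1)) h
        rw [add_mul, one_mul, map_add, PowerSeries.coeff_succ_X_mul, ih,
          PowerSeries.coeff_one, if_neg n.succ_ne_zero] at this
        rw [pow_succ]
        linear_combination this
    have hb : borel C (HahnSeries.single 1 1) = 1 := by
      ext n
      rw [coeff_borel, PowerSeries.coeff_one]
      split_ifs with h
      · simp [h]
      · rw [HahnSeries.coeff_single_of_ne (by omega), zero_div]
    ext n
    simp only [herr]
    rw [hb, mul_one, map_sub, coeff_borel, tau_single_one, coeff_expSeries,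
      PowerSeries.coeff_coe, if_neg (by omega), show ((n : ℤ) + 1).natAbs = n + 1 by omega,
      tOverOneAddT, PowerSeries.coeff_succ_X_mul, hrec, sub_self, map_zero]
  have h3 : ∀ g, ∃ h, err g = PowerSeries.X * err h := by
    intro g
    obtain ⟨c, h, rfl⟩ := exists_eq_single_add_theta g
    refine ⟨h, ?_⟩
    rw [← h1]
    have : err (c • HahnSeries.single 1 1 + theta C h) =
        c • err (HahnSeries.single 1 1) + err (theta C h) := by
      simp only [herr, map_add, tau_smul, map_smul, smul_sub, mul_add, mul_smul_comm]
      ring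
    rw [this, h2, smul_zero, zero_add]
  have h4 : ∀ (n : ℕ) g, PowerSeries.X ^ n ∣ err g := by
    intro n
    induction n with
    | zero => simp
    | succ n ih =>
      intro g
      obtain ⟨h, hh⟩ := h3 g
      rw [hh, pow_succ']
      exact mul_dvd_mul_left _ (ih h)
  refine sub_eq_zero.1 (PowerSeries.ext fun n => ?_)
  exact (PowerSeries.X_pow_dvd_iff.1 (h4 (n + 1) g)) n n.lt_succ_self

lemma expSeries_sub_one_ne_zero {a : C} (ha : a ≠ 0) : expSeries a - 1 ≠ 0 := by
  intro h
  have := congrArg (PowerSeries.coeff 1) h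
  rw [map_sub, coeff_expSeries, PowerSeries.coeff_one] at this
  simp [ha] at this

/-- A fixed element has (exp(-z) - 1)B(g) = 0, hence no positive powers of t. The same holds for its
inverse, so both orders are ≤ 0; they sum to 0, which leaves a constant. -/
lemma eq_C_of_tau_eq {g : C⸨X⸩} (hg : tau C g = g) : ∃ c, g = HahnSeries.C c := by
  rcases eq_or_ne g 0 with rfl | h0
  · exact ⟨0, by simp⟩
  have hpos : ∀ f : C⸨X⸩, tau C f = f → ∀ n : ℤ, 0 < n → f.coeff n = 0 := by
    intro f hf
    rw [← borel_eq_zero_iff]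
    have h := borel_tau f
    rw [hf] at h
    refine (mul_eq_zero.1 (?_ : (expSeries (-1) - 1) * borel C f = 0)).resolve_left
      (expSeries_sub_one_ne_zero (by simp))
    linear_combination -h
  have hord : ∀ f : C⸨X⸩, f ≠ 0 → tau C f = f → f.order ≤ 0 := by
    intro f hf0 hf
    by_contra! h
    exact HahnSeries.coeff_order_eq_zero.not.2 hf0 (hpos f hf _ h)
  have h1 := hord g h0 hg
  have h2 := hord g⁻¹ (inv_ne_zero h0) (by rw [map_inv₀, hg])
  have h3 := HahnSeries.order_mul h0 (inv_ne_zero h0)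
  rw [mul_inv_cancel₀ h0, HahnSeries.order_one] at h3
  refine ⟨g.coeff 0, ?_⟩
  ext n
  rw [HahnSeries.C_apply]
  rcases lt_trichotomy n 0 with h | rfl | h
  · rw [HahnSeries.coeff_eq_zero_of_lt_order (by omega), HahnSeries.coeff_single_of_ne (by omega)]
  · simp
  · rw [hpos g hg n h, HahnSeries.coeff_single_of_ne (by omega)]

/-- This is `borel_tau` read off coefficientwise; it provides the estimate that τ preserves
convergence. -/
lemma coeff_tau (g : C⸨X⸩) (n : ℕ) : (tau C g).coeff (n + 1) =
    ∑ x ∈ Finset.HasAntidiagonal.antidiagonal n, (-1) ^ x.1 * (n.choose x.1 : C) * g.coeff (x.2 + 1) := by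
  have h := congrArg (PowerSeries.coeff n) (borel_tau g)
  have hf : ∀ m : ℕ, (m.factorial : C) ≠ 0 := fun m => by exact_mod_cast m.factorial_ne_zero
  rw [coeff_borel, PowerSeries.coeff_mul, div_eq_iff (hf n), Finset.sum_mul] at h
  rw [h]
  refine Finset.sum_congr rfl fun x hx => ?_
  have hx' := Finset.HasAntidiagonal.mem_antidiagonal.1 hx
  rw [coeff_expSeries, coeff_borel]
  have hc : (n.choose x.1 : C) * x.1.factorial * x.2.factorial = n.factorial := by
    have := Nat.choose_mul_factorial_mul_factorial (show x.1 ≤ n by omega)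
    rw [show n - x.1 = x.2 by omega] at this
    exact_mod_cast this
  rw [← hc]
  have := hf x.1
  have := hf x.2
  field_simp

end Borel

/-! ### From algebraic to linear relations between solutions of τ(v) = v + f. -/

section Twist

open MvPolynomial

variable {σ K M : Type*} [Field K] [CommRing M] [Algebra K M]
  (τK : K →+* K) (f : σ → K)

/-- The endomorphism `P ↦ P^τ(X + f)` of a polynomial ring, semilinear with respect to `τ`. -/
def twist : MvPolynomial σ K →+* MvPolynomial σ K :=
  eval₂Hom (C.comp τK) fun i => X i + C (f i)

lemma twist_C (a : K) : twist τK f (C a) = C (τK a) := by simp [twist]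

lemma twist_X (i : σ) : twist τK f (X i) = X i + C (f i) := by simp [twist]

lemma aeval_twist {τM : M →+* M} (hτ : ∀ a, τM (algebraMap K M a) = algebraMap K M (τK a))
    {v : σ → M} (hv : ∀ i, τM (v i) = v i + algebraMap K M (f i)) (P : MvPolynomial σ K) :
    aeval v (twist τK f P) = τM (aeval v P) := by
  induction P using MvPolynomial.induction_on with
  | C a => rw [twist_C, aeval_C, aeval_C, hτ]
  | add p q hp hq => rw [map_add, map_add, map_add, map_add, hp, hq]
  | mul_X p i hp => rw [map_mul, map_mul, map_mul, map_mul, hp, twist_X, map_add, aeval_X,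
      aeval_C, hv]

lemma pderiv_twist (i : σ) (P : MvPolynomial σ K) :
    pderiv i (twist τK f P) = twist τK f (pderiv i P) := by
  classical
  induction P using MvPolynomial.induction_on with
  | C a => rw [twist_C, pderiv_C, pderiv_C, map_zero]
  | add p q hp hq => rw [map_add, map_add, map_add, map_add, hp, hq]
  | mul_X p j hp =>
    rw [map_mul, pderiv_mul, pderiv_mul, map_add, map_mul, map_mul, hp, twist_X, map_add,
      pderiv_C, add_zero, pderiv_X]
    congr 2
    by_cases h : j = i
    · subst h; simp
    · simp [h]

/-- For the degree-lexicographic order, the image of the monomial Xᵃ is monic of degree a. So a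
monomial of P strictly below b contributes nothing to the coefficient at b. -/
lemma coeff_twist_of_degree_le [LinearOrder σ] [WellFoundedGT σ] (P : MvPolynomial σ K)
    {b : σ →₀ ℕ} (hb : MonomialOrder.degLex.toSyn (MonomialOrder.degLex.degree P) ≤
      MonomialOrder.degLex.toSyn b) :
    coeff b (twist τK f P) = τK (coeff b P) := by
  classical
  set m : MonomialOrder σ := MonomialOrder.degLex
  set Q : (σ →₀ ℕ) → MvPolynomial σ K := fun a => a.prod fun i k => (X i + C (f i)) ^ k with hQ
  have hlin : ∀ i, m.toSyn (m.degree (C (f i))) <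
      m.toSyn (m.degree (X i : MvPolynomial σ K)) := by
    intro i
    rw [MonomialOrder.degree_C, MonomialOrder.degree_X, map_zero]
    exact m.toSyn_lt_iff_ne_zero.2 (by simp)
  have hmonic : ∀ i, m.Monic (X i + C (f i)) := fun i => m.monic_X.add_of_lt (hlin i)
  have hdeg : ∀ a, m.degree (Q a) = a := by
    intro a
    simp only [hQ]
    rw [Finsupp.prod, MonomialOrder.degree_prod]
    · conv_rhs => rw [← Finsupp.sum_single a, Finsupp.sum]
      refine Finset.sum_congr rfl fun i _ => ?_
      rw [MonomialOrder.degree_pow, MonomialOrder.degree_add_of_lt (hlin i),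
        MonomialOrder.degree_X]
      simp
    · intro i _
      exact pow_ne_zero _ (hmonic i).ne_zero
  have hQm : ∀ a, coeff a (Q a) = 1 := by
    intro a
    have : m.Monic (Q a) := MonomialOrder.Monic.prod fun i _ => (hmonic i).pow
    simpa [hdeg] using this.coeff_degree
  have hsum : twist τK f P = ∑ a ∈ P.support, C (τK (coeff a P)) * Q a := by
    rw [twist, coe_eval₂Hom, eval₂_eq]
    rfl
  rw [hsum, coeff_sum]
  simp only [coeff_C_mul]
  have hzero : ∀ a ∈ P.support, a ≠ b → τK (coeff a P) * coeff b (Q a) = 0 := by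
    intro a ha hab
    rw [m.coeff_eq_zero_of_lt (f := Q a), mul_zero]
    rw [hdeg]
    exact lt_of_le_of_ne ((m.le_degree ha).trans hb) (m.toSyn.injective.ne hab)
  rw [Finset.sum_eq_single b hzero]
  · rw [hQm, mul_one]
  · intro h
    rw [notMem_support_iff.1 h]; simp

/-- A relation Q of least degree, normalised to leading coefficient 1, is invariant: `twist`
preserves relations and that leading term, so twist(Q) - Q would otherwise be a smaller relation. -/
lemma exists_twist_eq_self [Finite σ] {τM : M →+* M}
    (hτ : ∀ a, τM (algebraMap K M a) = algebraMap K M (τK a))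
    {v : σ → M} (hv : ∀ i, τM (v i) = v i + algebraMap K M (f i))
    {P : MvPolynomial σ K} (hP : P ≠ 0) (hPv : aeval v P = 0) :
    ∃ Q : MvPolynomial σ K, Q ≠ 0 ∧ aeval v Q = 0 ∧ twist τK f Q = Q := by
  classical
  cases nonempty_fintype σ
  let _ : LinearOrder σ := LinearOrder.lift' (Fintype.equivFin σ) (Fintype.equivFin σ).injective
  set m : MonomialOrder σ := MonomialOrder.degLex
  obtain ⟨Q₀, ⟨hQ₀, hQ₀v⟩, hmin⟩ := (InvImage.wf
    (fun P : MvPolynomial σ K => m.toSyn (m.degree P)) wellFounded_lt).has_min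
    {P | P ≠ 0 ∧ aeval v P = 0} ⟨P, hP, hPv⟩
  have hlc : m.leadingCoeff Q₀ ≠ 0 := m.leadingCoeff_ne_zero_iff.2 hQ₀
  have hlc' : coeff (m.degree Q₀) Q₀ ≠ 0 := hlc
  set c := coeff (m.degree Q₀) Q₀ with hc
  set Q := C c⁻¹ * Q₀ with hQ
  have hQne : Q ≠ 0 := mul_ne_zero (by simpa using hlc') hQ₀
  have hdeg : m.degree Q = m.degree Q₀ := by
    rw [hQ, m.degree_mul (by simpa using hlc') hQ₀, m.degree_C, zero_add]
  have hQv : aeval v Q = 0 := by rw [hQ, map_mul, hQ₀v, mul_zero]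
  refine ⟨Q, hQne, hQv, ?_⟩
  by_contra hne
  have hR : twist τK f Q - Q ≠ 0 := sub_ne_zero.2 hne
  refine hmin (twist τK f Q - Q) ⟨hR, ?_⟩ ?_
  · rw [map_sub, aeval_twist τK f hτ hv, hQv, map_zero, sub_zero]
  · change m.toSyn (m.degree (twist τK f Q - Q)) < m.toSyn (m.degree Q₀)
    rw [← hdeg]
    by_contra! hle
    have h1 := m.coeff_degree_ne_zero_iff.2 hR
    rw [coeff_sub, coeff_twist_of_degree_le τK f Q hle] at h1
    rcases hle.eq_or_lt with h | h
    · rw [← m.toSyn.injective h, hdeg, hQ, coeff_C_mul, inv_mul_cancel₀ hlc', map_one,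
        sub_self] at h1
      exact h1 rfl
    · rw [m.coeff_eq_zero_of_lt h, map_zero, sub_zero] at h1
      exact h1 rfl

lemma eq_C_of_pderiv_eq_zero [CharZero K] {P : MvPolynomial σ K} (h : ∀ i, pderiv i P = 0) :
    P = C (coeff 0 P) := by
  classical
  ext d
  rw [coeff_C]
  split_ifs with hd
  · rw [hd]
  · obtain ⟨i, hi⟩ := Finsupp.ne_iff.1 (Ne.symm hd)
    have hi' : d i ≠ 0 := hi
    have hd' : d - Finsupp.single i 1 + Finsupp.single i 1 = d :=
      tsub_add_cancel_of_le (by simpa using Nat.one_le_iff_ne_zero.2 hi')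
    have := congrArg (coeff (d - Finsupp.single i 1)) (h i)
    rw [coeff_pderiv, hd', coeff_zero, mul_eq_zero] at this
    exact this.resolve_right (Nat.cast_add_one_ne_zero _)

lemma totalDegree_pderiv_lt {P : MvPolynomial σ K} {i : σ} (h : pderiv i P ≠ 0) :
    (pderiv i P).totalDegree < P.totalDegree := by
  obtain ⟨d, hd, hmax⟩ := Finset.exists_mem_eq_sup _ (support_nonempty.2 h)
    fun s : σ →₀ ℕ => s.sum fun _ e => e
  rw [mem_support_iff, coeff_pderiv] at hd
  have h1 := le_totalDegree (mem_support_iff.2 (left_ne_zero_of_mul hd))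
  rw [totalDegree, hmax]
  rw [Finsupp.sum_add_index' (by simp) (by simp)] at h1
  simp at h1
  omega

/-- Partial derivatives commute with `twist`, so a nonconstant one is again invariant, of smaller
degree. The descent stops when all partial derivatives are constant; in characteristic zero the
polynomial is then affine, and invariance of the partials makes its coefficients fixed by τ. -/
lemma exists_linear_of_twist_eq_self [Fintype σ] [CharZero K] (N : ℕ) :
    ∀ {P : MvPolynomial σ K}, P.totalDegree ≤ N → (∀ a, P ≠ C a) → twist τK f P = P →
    ∃ (c : σ → K) (b : K), c ≠ 0 ∧ (∀ i, τK (c i) = c i) ∧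
      twist τK f (∑ i, C (c i) * X i + C b) = ∑ i, C (c i) * X i + C b := by
  classical
  induction N with
  | zero =>
    intro P hN hP _
    exact absurd (totalDegree_eq_zero_iff_eq_C.1 (Nat.le_zero.1 hN)) (hP _)
  | succ N ih =>
    intro P hN hP hPt
    by_cases hex : ∃ i, ∀ a, pderiv i P ≠ C a
    · obtain ⟨i, hi⟩ := hex
      refine ih (P := pderiv i P) ?_ hi (by rw [← pderiv_twist, hPt])
      have := totalDegree_pderiv_lt (P := P) (i := i) (by simpa using hi 0)
      omega
    · push Not at hex
      choose c hc using hex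
      have hlin : P - ∑ i, C (c i) * X i =
          C (coeff 0 (P - ∑ i, C (c i) * X i)) := by
        refine eq_C_of_pderiv_eq_zero fun i => ?_
        rw [map_sub, map_sum, hc, Finset.sum_eq_single i]
        · simp
        · intro j _ hj
          rw [pderiv_C_mul, pderiv_X_of_ne hj, mul_zero]
        · simp
      refine ⟨c, coeff 0 (P - ∑ i, C (c i) * X i), ?_, fun i => ?_, ?_⟩
      · rintro rfl
        exact hP _ (eq_C_of_pderiv_eq_zero fun i => by simpa using hc i)
      · have := pderiv_twist τK f i P
        rw [hPt, hc, twist_C] at this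
        exact (C_injective _ _ this).symm
      · rw [← hlin, add_sub_cancel, hPt]

/-- If finitely many solutions of difference equations `τ(v) = v + f` with `f ∈ K` are
algebraically dependent over `K`, then a nontrivial combination of them with `τ`-invariant
coefficients is, up to an element of `K`, invariant under `τ`. -/
theorem exists_linear_relation [Fintype σ] [Nontrivial M] [CharZero K] {τM : M →+* M}
    (hτ : ∀ a, τM (algebraMap K M a) = algebraMap K M (τK a))
    {v : σ → M} (hv : ∀ i, τM (v i) = v i + algebraMap K M (f i))
    {P : MvPolynomial σ K} (hP : P ≠ 0) (hPv : aeval v P = 0) :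
    ∃ (c : σ → K) (b : K), c ≠ 0 ∧ (∀ i, τK (c i) = c i) ∧
      τM (∑ i, algebraMap K M (c i) * v i + algebraMap K M b) =
        ∑ i, algebraMap K M (c i) * v i + algebraMap K M b := by
  obtain ⟨Q, hQ, hQv, hQt⟩ := exists_twist_eq_self τK f hτ hv hP hPv
  obtain ⟨c, b, hc, hcτ, h⟩ := exists_linear_of_twist_eq_self τK f Q.totalDegree le_rfl (P := Q)
    (by
      rintro a rfl
      rw [aeval_C, map_eq_zero_iff _ (algebraMap K M).injective] at hQv
      simp [hQv] at hQ) hQt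
  refine ⟨c, b, hc, hcτ, ?_⟩
  have := aeval_twist τK f hτ hv (∑ i, C (c i) * X i + C b)
  rw [h] at this
  simpa using this.symm

/-- Algebraic dependence is preserved under invertible linear changes of the elements. -/
lemma exists_aeval_eq_zero_of_linear [Fintype σ] [DecidableEq σ] {v u : σ → M}
    {A : Matrix σ σ K} (hA : A.det ≠ 0)
    (hu : ∀ i, u i = ∑ j, A i j • v j) {P : MvPolynomial σ K} (hP : P ≠ 0)
    (hPu : aeval u P = 0) : ∃ Q : MvPolynomial σ K, Q ≠ 0 ∧ aeval v Q = 0 := by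
  set Φ : Matrix σ σ K → MvPolynomial σ K →ₐ[K] MvPolynomial σ K :=
    fun B => aeval fun i => ∑ j, B i j • X j with hΦ
  refine ⟨Φ A P, fun h => hP ?_, ?_⟩
  · have hAu : IsUnit A.det := hA.isUnit
    have h1 : ∀ R, Φ A⁻¹ (Φ A R) = R := by
      intro R
      have : (Φ A⁻¹).comp (Φ A) = AlgHom.id K _ := by
        refine algHom_ext fun i => ?_
        rw [AlgHom.comp_apply, hΦ]
        simp only [aeval_X, map_sum, map_smul, AlgHom.id_apply]
        simp only [Finset.smul_sum, smul_smul]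
        rw [Finset.sum_comm]
        simp only [← Finset.sum_smul, ← Matrix.mul_apply, Matrix.mul_nonsing_inv A hAu,
          Matrix.one_apply]
        simp
      exact DFunLike.congr_fun this R
    rw [← h1 P, h, map_zero]
  · rw [← hPu, hΦ, ← AlgHom.comp_apply]
    congr 1
    refine algHom_ext fun i => ?_
    simp [hu]

end Twist

/-! ### Exponential polynomials are the Borel transforms of rational functions. -/

section ExpPoly

variable {C : Type*} [Field C] [CharZero C]

variable (C) in
/-- The space of exponential polynomials `∑ cₖₐ zᵏ exp(a z)`, as formal power series. -/
def expPoly : Submodule C C⟦X⟧ :=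
  Submodule.span C (Set.range fun x : ℕ × C => PowerSeries.X ^ x.1 * expSeries x.2)

lemma X_pow_mul_expSeries_mem (k : ℕ) (a : C) :
    PowerSeries.X ^ k * expSeries a ∈ expPoly C :=
  Submodule.subset_span ⟨(k, a), rfl⟩

/-- Induction principle for exponential polynomials. -/
lemma expPoly_induction {p : C⟦X⟧ → Prop} (h : ∀ k a, p (PowerSeries.X ^ k * expSeries a))
    (h0 : p 0) (hadd : ∀ x y, p x → p y → p (x + y)) (hsmul : ∀ (c : C) x, p x → p (c • x))
    {s : C⟦X⟧} (hs : s ∈ expPoly C) : p s := by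
  induction hs using Submodule.span_induction with
  | mem x hx => obtain ⟨⟨k, a⟩, rfl⟩ := hx; exact h k a
  | zero => exact h0
  | add x y _ _ hx hy => exact hadd x y hx hy
  | smul c x _ hx => exact hsmul c x hx

lemma expSeries_mul_mem (b : C) {s : C⟦X⟧} (hs : s ∈ expPoly C) :
    expSeries b * s ∈ expPoly C := by
  refine expPoly_induction (p := fun s => expSeries b * s ∈ expPoly C) (fun k a => ?_) ?_ ?_ ?_ hs
  · rw [mul_left_comm, ← expSeries_add]
    exact X_pow_mul_expSeries_mem _ _
  · simp
  · intro x y hx hy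
    rw [mul_add]
    exact add_mem hx hy
  · intro c x hx
    rw [mul_smul_comm]
    exact Submodule.smul_mem _ _ hx

lemma X_mul_mem {s : C⟦X⟧} (hs : s ∈ expPoly C) : PowerSeries.X * s ∈ expPoly C := by
  refine expPoly_induction (p := fun s => PowerSeries.X * s ∈ expPoly C) (fun k a => ?_)
    ?_ ?_ ?_ hs
  · rw [← mul_assoc, ← pow_succ']
    exact X_pow_mul_expSeries_mem _ _
  · simp
  · intro x y hx hy
    rw [mul_add]
    exact add_mem hx hy
  · intro c x hx
    rw [mul_smul_comm]
    exact Submodule.smul_mem _ _ hx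

lemma polynomial_mul_mem (q : Polynomial C) {s : C⟦X⟧} (hs : s ∈ expPoly C) :
    (q : C⟦X⟧) * s ∈ expPoly C := by
  induction q using Polynomial.induction_on with
  | C a =>
    rw [Polynomial.coe_C, ← PowerSeries.smul_eq_C_mul]
    exact Submodule.smul_mem _ _ hs
  | add p q hp hq =>
    rw [Polynomial.coe_add, add_mul]
    exact add_mem hp hq
  | monomial n a h =>
    rw [pow_succ, ← mul_assoc, Polynomial.coe_mul, Polynomial.coe_X,
      mul_comm _ (PowerSeries.X : C⟦X⟧), mul_assoc]
    exact X_mul_mem h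

lemma exists_sum_eq_of_mem_expPoly {s : C⟦X⟧} (hs : s ∈ expPoly C) :
    ∃ p : C →₀ Polynomial C, s = p.sum fun a q => (q : C⟦X⟧) * expSeries a := by
  classical
  refine expPoly_induction
    (p := fun s => ∃ p : C →₀ Polynomial C, s = p.sum fun a q => (q : C⟦X⟧) * expSeries a)
    (fun k a => ⟨Finsupp.single a (Polynomial.X ^ k), ?_⟩) ⟨0, by simp⟩ ?_ ?_ hs
  · rw [Finsupp.sum_single_index (by simp)]
    simp
  · rintro _ _ ⟨p, rfl⟩ ⟨q, rfl⟩
    exact ⟨p + q, (Finsupp.sum_add_index' (by simp) (by simp [add_mul])).symm⟩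
  · rintro c _ ⟨p, rfl⟩
    refine ⟨p.mapRange (Polynomial.C c * ·) (mul_zero _), ?_⟩
    rw [Finsupp.sum_mapRange_index (by simp), Finsupp.smul_sum]
    simp [PowerSeries.smul_eq_C_mul, mul_assoc]

lemma derivative_expSeries (a : C) :
    PowerSeries.derivative C (expSeries a) = a • expSeries a := by
  ext n
  rw [PowerSeries.coeff_derivative, coeff_expSeries, map_smul, coeff_expSeries,
    Nat.factorial_succ, smul_eq_mul]
  have h1 : (n + 1 : C) ≠ 0 := Nat.cast_add_one_ne_zero n
  have h2 : (n.factorial : C) ≠ 0 := by exact_mod_cast n.factorial_ne_zero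
  push_cast
  field_simp
  ring

omit [CharZero C] in
lemma derivative_smul (c : C) (s : C⟦X⟧) :
    PowerSeries.derivative C (c • s) = c • PowerSeries.derivative C s := by
  rw [PowerSeries.smul_eq_C_mul, PowerSeries.smul_eq_C_mul, Derivation.leibniz,
    PowerSeries.derivative_C]
  simp

lemma derivative_X_pow_succ_mul_expSeries (k : ℕ) (a : C) :
    PowerSeries.derivative C (PowerSeries.X ^ (k + 1) * expSeries a) =
      (k + 1 : C) • (PowerSeries.X ^ k * expSeries a) +
        a • (PowerSeries.X ^ (k + 1) * expSeries a) := by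
  rw [Derivation.leibniz, derivative_expSeries, PowerSeries.derivative_pow,
    PowerSeries.derivative_X]
  simp only [PowerSeries.smul_eq_C_mul, smul_eq_mul, map_add, map_one, map_natCast]
  push_cast
  simp
  ring

lemma derivative_mem {s : C⟦X⟧} (hs : s ∈ expPoly C) :
    PowerSeries.derivative C s ∈ expPoly C := by
  refine expPoly_induction (p := fun s => PowerSeries.derivative C s ∈ expPoly C)
    (fun k a => ?_) ?_ ?_ ?_ hs
  · cases k with
    | zero =>
      have := X_pow_mul_expSeries_mem 0 a
      rw [pow_zero, one_mul] at this ⊢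
      rw [derivative_expSeries]
      exact Submodule.smul_mem _ _ this
    | succ k =>
      rw [derivative_X_pow_succ_mul_expSeries]
      exact add_mem (Submodule.smul_mem _ _ (X_pow_mul_expSeries_mem _ _))
        (Submodule.smul_mem _ _ (X_pow_mul_expSeries_mem _ _))
  · simp
  · intro x y hx hy
    rw [map_add]
    exact add_mem hx hy
  · intro c x hx
    rw [derivative_smul]
    exact Submodule.smul_mem _ _ hx

lemma exists_derivative_eq {s : C⟦X⟧} (hs : s ∈ expPoly C) :
    ∃ y ∈ expPoly C, PowerSeries.derivative C y = s := by
  refine expPoly_induction (p := fun s => ∃ y ∈ expPoly C, PowerSeries.derivative C y = s)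
    (fun k a => ?_) ⟨0, zero_mem _, map_zero _⟩ ?_ ?_ hs
  · rcases eq_or_ne a 0 with rfl | ha
    · refine ⟨(k + 1 : C)⁻¹ • (PowerSeries.X ^ (k + 1) * expSeries 0),
        Submodule.smul_mem _ _ (X_pow_mul_expSeries_mem _ _), ?_⟩
      rw [derivative_smul, derivative_X_pow_succ_mul_expSeries, zero_smul, add_zero, smul_smul,
        inv_mul_cancel₀ (Nat.cast_add_one_ne_zero k), one_smul]
    · induction k with
      | zero =>
        refine ⟨a⁻¹ • expSeries a, Submodule.smul_mem _ _ ?_, ?_⟩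
        · simpa using X_pow_mul_expSeries_mem 0 a
        · rw [derivative_smul, derivative_expSeries, smul_smul, inv_mul_cancel₀ ha]
          simp
      | succ k ih =>
        obtain ⟨y, hy, hy'⟩ := ih
        refine ⟨a⁻¹ • (PowerSeries.X ^ (k + 1) * expSeries a - (k + 1 : C) • y),
          Submodule.smul_mem _ _ (sub_mem (X_pow_mul_expSeries_mem _ _)
            (Submodule.smul_mem _ _ hy)), ?_⟩
        rw [derivative_smul, map_sub, derivative_X_pow_succ_mul_expSeries, derivative_smul, hy',
          add_sub_cancel_left, smul_smul, inv_mul_cancel₀ ha, one_smul]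
  · rintro x y ⟨u, hu, rfl⟩ ⟨v, hv, rfl⟩
    exact ⟨u + v, add_mem hu hv, map_add _ _ _⟩
  · rintro c x ⟨u, hu, rfl⟩
    exact ⟨c • u, Submodule.smul_mem _ _ hu, derivative_smul _ _⟩

lemma mem_of_derivative_mem {y : C⟦X⟧} (hy : PowerSeries.derivative C y ∈ expPoly C) :
    y ∈ expPoly C := by
  obtain ⟨u, hu, h⟩ := exists_derivative_eq hy
  have h1 : y - u = PowerSeries.constantCoeff (y - u) • (PowerSeries.X ^ 0 * expSeries 0) := by
    refine PowerSeries.derivative.ext ?_ ?_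
    · rw [map_sub, h, sub_self, derivative_smul, pow_zero, one_mul, expSeries_zero,
        PowerSeries.derivative_one, smul_zero]
    · simp [expSeries_zero]
  rw [← sub_add_cancel y u, h1]
  exact add_mem (Submodule.smul_mem _ _ (X_pow_mul_expSeries_mem _ _)) hu

/-- The integrating factor exp(-az) turns the left side of y' - ay = s into an exact derivative, and
exponential polynomials are closed under antiderivatives. -/
lemma mem_of_derivative_sub_smul_mem {y : C⟦X⟧} (a : C)
    (hy : PowerSeries.derivative C y - a • y ∈ expPoly C) : y ∈ expPoly C := by
  have h : expSeries a * (expSeries (-a) * y) = y := by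
    rw [← mul_assoc, ← expSeries_add, add_neg_cancel, expSeries_zero, one_mul]
  rw [← h]
  refine expSeries_mul_mem a (mem_of_derivative_mem ?_)
  have : PowerSeries.derivative C (expSeries (-a) * y) =
      expSeries (-a) * (PowerSeries.derivative C y - a • y) := by
    rw [Derivation.leibniz, derivative_expSeries]
    simp only [smul_eq_mul, PowerSeries.smul_eq_C_mul, map_neg]
    ring
  rw [this]
  exact expSeries_mul_mem _ hy

lemma borel_single_neg_one_mul (g : C⸨X⸩) :
    borel C (HahnSeries.single (-1) 1 * g) = PowerSeries.derivative C (borel C g) := by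
  ext n
  rw [coeff_borel, PowerSeries.coeff_derivative, coeff_borel, HahnSeries.coeff_single_mul,
    one_mul, Nat.factorial_succ, show (n : ℤ) + 1 - -1 = (n : ℤ) + 1 + 1 by ring]
  have h1 : (n + 1 : C) ≠ 0 := Nat.cast_add_one_ne_zero n
  have h2 : (n.factorial : C) ≠ 0 := by exact_mod_cast n.factorial_ne_zero
  push_cast
  field_simp

omit [CharZero C] in
lemma borel_C_mul (c : C) (g : C⸨X⸩) : borel C (HahnSeries.C c * g) = c • borel C g := by
  rw [HahnSeries.C_mul_eq_smul, map_smul]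

/-- Multiplication by 1/t - a becomes d/dz - a under the Borel transform. -/
lemma borel_mem_of_mul {a : C} {g : C⸨X⸩}
    (h : borel C ((HahnSeries.single (-1) 1 - HahnSeries.C a) * g) ∈ expPoly C) :
    borel C g ∈ expPoly C := by
  refine mem_of_derivative_sub_smul_mem a ?_
  rwa [sub_mul, map_sub, borel_single_neg_one_mul, borel_C_mul] at h

omit [CharZero C] in
lemma single_neg_one_mul_single_one_mul (g : C⸨X⸩) :
    HahnSeries.single (-1) 1 * (HahnSeries.single 1 1 * g) = g := by
  rw [← mul_assoc, HahnSeries.single_mul_single]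
  simp

lemma borel_single_one_mul_mem {g : C⸨X⸩} (h : borel C g ∈ expPoly C) :
    borel C (HahnSeries.single 1 1 * g) ∈ expPoly C := by
  refine borel_mem_of_mul (a := 0) ?_
  rwa [map_zero, sub_zero, single_neg_one_mul_single_one_mul]

lemma borel_inv_mul_mem {c : C} {g : C⸨X⸩} (h : borel C g ∈ expPoly C) :
    borel C ((HahnSeries.single 1 1 - HahnSeries.C c)⁻¹ * g) ∈ expPoly C := by
  have hx : borel C (HahnSeries.single (-1) 1 * g) ∈ expPoly C := by
    rw [borel_single_neg_one_mul]
    exact derivative_mem h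
  have hne : (HahnSeries.single 1 1 - HahnSeries.C c : C⸨X⸩) ≠ 0 := by
    intro h
    have := congrArg (fun f => HahnSeries.coeff f 1) h
    simp [HahnSeries.C_apply] at this
  set k := (HahnSeries.single 1 1 - HahnSeries.C c : C⸨X⸩)⁻¹ * g with hk
  have hkg : (HahnSeries.single 1 1 - HahnSeries.C c) * k = g := by
    rw [hk, ← mul_assoc, mul_inv_cancel₀ hne, one_mul]
  -- Dividing (t - c)k = g by t gives (1 - c/t)k = g/t. For c ≠ 0 this is (1/t - 1/c)k = -c⁻¹g/t, to
  -- which `borel_mem_of_mul` applies.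
  have h1 : k - HahnSeries.C c * (HahnSeries.single (-1) 1 * k) =
      HahnSeries.single (-1) 1 * g := by
    conv_rhs => rw [← hkg, sub_mul, mul_sub, single_neg_one_mul_single_one_mul]
    ring
  rcases eq_or_ne c 0 with rfl | hc
  · rw [map_zero, zero_mul, sub_zero] at h1
    rwa [h1]
  · refine borel_mem_of_mul (a := c⁻¹) ?_
    have h2 : (HahnSeries.single (-1) 1 - HahnSeries.C c⁻¹) * k =
        HahnSeries.C (-c⁻¹) * (HahnSeries.single (-1) 1 * g) := by
      have h3 : (HahnSeries.C c⁻¹ * HahnSeries.C c : C⸨X⸩) = 1 := by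
        rw [← map_mul, inv_mul_cancel₀ hc, map_one]
      rw [← h1, map_neg]
      linear_combination (-HahnSeries.single (-1) 1 * k) * h3
    rw [h2, borel_C_mul]
    exact Submodule.smul_mem _ _ hx

omit [CharZero C] in
lemma algebraMap_polynomial_X :
    algebraMap (Polynomial C) C⸨X⸩ Polynomial.X = HahnSeries.single 1 1 := by
  rw [IsScalarTower.algebraMap_apply (Polynomial C) (RatFunc C) C⸨X⸩, RatFunc.algebraMap_X,
    RatFunc.coe_X]

omit [CharZero C] in
lemma algebraMap_polynomial_C (c : C) :
    algebraMap (Polynomial C) C⸨X⸩ (Polynomial.C c) = HahnSeries.C c := by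
  rw [Polynomial.algebraMap_hahnSeries_apply, Polynomial.coe_C, HahnSeries.ofPowerSeries_C]

omit [CharZero C] in
/-- A subfield of `C((t))` that contains `C` and `t` contains `C(t)`. -/
lemma algebraMap_ratFunc_mem {F : Subfield C⸨X⸩} (hC : ∀ c, HahnSeries.C c ∈ F)
    (hX : HahnSeries.single 1 1 ∈ F) (r : RatFunc C) :
    algebraMap (RatFunc C) C⸨X⸩ r ∈ F := by
  have hp : ∀ p : Polynomial C, algebraMap (Polynomial C) C⸨X⸩ p ∈ F := by
    intro p
    induction p using Polynomial.induction_on with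
    | C a => rw [algebraMap_polynomial_C]; exact hC a
    | add p q hp hq => rw [map_add]; exact add_mem hp hq
    | monomial n a h =>
      rw [pow_succ, ← mul_assoc, map_mul, algebraMap_polynomial_X]
      exact mul_mem h hX
  induction r using RatFunc.induction_on with
  | f p q hq =>
    rw [RatFunc.algebraMap_apply_div]
    exact div_mem (hp p) (hp q)

lemma borel_polynomial_mul_mem (p : Polynomial C) {g : C⸨X⸩} (h : borel C g ∈ expPoly C) :
    borel C (algebraMap (Polynomial C) C⸨X⸩ p * g) ∈ expPoly C := by
  induction p using Polynomial.induction_on with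
  | C a =>
    rw [algebraMap_polynomial_C, borel_C_mul]
    exact Submodule.smul_mem _ _ h
  | add p q hp hq =>
    rw [map_add, add_mul, map_add]
    exact add_mem hp hq
  | monomial n a h =>
    rw [pow_succ, ← mul_assoc, map_mul (algebraMap _ _), algebraMap_polynomial_X,
      mul_comm _ (HahnSeries.single (1 : ℤ) (1 : C)), mul_assoc]
    exact borel_single_one_mul_mem h

/-- Over an algebraically closed field the denominator splits, so its linear factors are inverted
one at a time. -/
lemma borel_polynomial_inv_mul_mem [IsAlgClosed C] (p : Polynomial C) {g : C⸨X⸩}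
    (h : borel C g ∈ expPoly C) :
    borel C ((algebraMap (Polynomial C) C⸨X⸩ p)⁻¹ * g) ∈ expPoly C := by
  have hprod : ∀ s : Multiset C, borel C ((algebraMap (Polynomial C) C⸨X⸩
      (s.map fun a => Polynomial.X - Polynomial.C a).prod)⁻¹ * g) ∈ expPoly C := by
    intro s
    induction s using Multiset.induction_on with
    | empty => simpa using h
    | cons a s ih =>
      rw [Multiset.map_cons, Multiset.prod_cons, map_mul (algebraMap _ _), map_sub, algebraMap_polynomial_X,
        algebraMap_polynomial_C, mul_inv, mul_assoc]
      exact borel_inv_mul_mem ih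
  rw [(IsAlgClosed.splits p).eq_prod_roots, map_mul (algebraMap _ _), mul_inv, algebraMap_polynomial_C,
    ← map_inv₀, mul_assoc, borel_C_mul]
  exact Submodule.smul_mem _ _ (hprod _)

/-- The Borel transform of a rational function is an exponential polynomial. -/
lemma borel_algebraMap_ratFunc_mem [IsAlgClosed C] (r : RatFunc C) :
    borel C (algebraMap (RatFunc C) C⸨X⸩ r) ∈ expPoly C := by
  have h1 : borel C (1 : C⸨X⸩) ∈ expPoly C := by
    rw [(borel_eq_zero_iff _).2 fun n hn => by simp [HahnSeries.coeff_one, hn.ne']]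
    exact zero_mem _
  induction r using RatFunc.induction_on with
  | f p q hq =>
    rw [RatFunc.algebraMap_apply_div, div_eq_inv_mul]
    refine borel_polynomial_inv_mul_mem q ?_
    simpa using borel_polynomial_mul_mem p h1

omit [CharZero C] in
lemma theta_single_one : theta C (HahnSeries.single 1 1) = HahnSeries.single 1 1 ^ 2 := by
  ext n
  rw [coeff_theta, sq, HahnSeries.coeff_single_mul, one_mul]
  rcases eq_or_ne n 2 with rfl | h
  · norm_num
  · rw [HahnSeries.coeff_single_of_ne (by omega), mul_zero]

omit [CharZero C] in
lemma theta_mem_ratFunc_range {g : C⸨X⸩} (hg : g ∈ (algebraMap (RatFunc C) C⸨X⸩).fieldRange) :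
    theta C g ∈ (algebraMap (RatFunc C) C⸨X⸩).fieldRange := by
  set R := (algebraMap (RatFunc C) C⸨X⸩).fieldRange
  -- The rational elements with rational image under θ form a subfield, so only constants and t need
  -- checking.
  let F : Subfield C⸨X⸩ :=
    { carrier := {g | g ∈ R ∧ theta C g ∈ R}
      mul_mem' := fun {a b} ha hb => ⟨mul_mem ha.1 hb.1, by
        rw [theta_mul]
        exact add_mem (mul_mem ha.1 hb.2) (mul_mem ha.2 hb.1)⟩
      one_mem' := ⟨one_mem _, by rw [theta_one]; exact zero_mem _⟩
      add_mem' := fun {a b} ha hb => ⟨add_mem ha.1 hb.1, by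
        rw [map_add]
        exact add_mem ha.2 hb.2⟩
      zero_mem' := ⟨zero_mem _, by rw [map_zero]; exact zero_mem _⟩
      neg_mem' := fun {a} ha => ⟨neg_mem ha.1, by rw [map_neg]; exact neg_mem ha.2⟩
      inv_mem' := fun a ha => ⟨inv_mem ha.1, by
        rcases eq_or_ne a 0 with rfl | h0
        · rw [inv_zero, map_zero]; exact zero_mem _
        have h := theta_mul a a⁻¹
        rw [mul_inv_cancel₀ h0, theta_one] at h
        have : theta C a⁻¹ = -(a⁻¹ * (theta C a * a⁻¹)) := by
          have h2 : a⁻¹ * a = 1 := inv_mul_cancel₀ h0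
          linear_combination (-a⁻¹) * h - theta C a⁻¹ * h2
        rw [this]
        exact neg_mem (mul_mem (inv_mem ha.1) (mul_mem ha.2 (inv_mem ha.1)))⟩ }
  obtain ⟨r, rfl⟩ := hg
  have hX : HahnSeries.single 1 1 ∈ R := ⟨RatFunc.X, RatFunc.coe_X⟩
  refine (algebraMap_ratFunc_mem (F := F) (fun c => ⟨⟨RatFunc.C c, ?_⟩, ?_⟩) ⟨hX, ?_⟩ r).2
  · rw [← RatFunc.algebraMap_C, ← IsScalarTower.algebraMap_apply, algebraMap_polynomial_C]
  · rw [theta_C]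
    exact zero_mem _
  · rw [theta_single_one]
    exact pow_mem hX 2

/-- Every exponential polynomial is the Borel transform of a rational function. -/
lemma exists_borel_ratFunc_eq {s : C⟦X⟧} (hs : s ∈ expPoly C) :
    ∃ r ∈ (algebraMap (RatFunc C) C⸨X⸩).fieldRange, borel C r = s := by
  have hCm : ∀ c : C, HahnSeries.C c ∈ (algebraMap (RatFunc C) C⸨X⸩).fieldRange := fun c =>
    ⟨RatFunc.C c, by
      rw [← RatFunc.algebraMap_C, ← IsScalarTower.algebraMap_apply, algebraMap_polynomial_C]⟩
  refine expPoly_induction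
    (p := fun s => ∃ r ∈ (algebraMap (RatFunc C) C⸨X⸩).fieldRange, borel C r = s)
    (fun k a => ?_) ⟨0, zero_mem _, map_zero _⟩ ?_ ?_ hs
  · set h : C⸨X⸩ := HahnSeries.ofPowerSeries ℤ C (PowerSeries.X * PowerSeries.mk fun n => a ^ n)
    have hb : borel C h = expSeries a := by
      ext n
      rw [coeff_borel, PowerSeries.coeff_coe, if_neg (by omega),
        show ((n : ℤ) + 1).natAbs = n + 1 by omega, PowerSeries.coeff_succ_X_mul,
        PowerSeries.coeff_mk, coeff_expSeries]
    have hinv : (HahnSeries.single (-1) 1 - HahnSeries.C a) * h = 1 := by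
      have h1 : PowerSeries.mk (fun n => a ^ n) =
          1 + PowerSeries.C a * (PowerSeries.X * PowerSeries.mk fun n => a ^ n) := by
        ext n
        cases n with
        | zero => simp
        | succ n =>
          rw [map_add, PowerSeries.coeff_C_mul, PowerSeries.coeff_succ_X_mul]
          simp [PowerSeries.coeff_one, pow_succ']
      have h2 := congrArg (HahnSeries.ofPowerSeries ℤ C) h1
      rw [map_add, map_mul, map_one, HahnSeries.ofPowerSeries_C] at h2
      have h3 : HahnSeries.single (-1) 1 * h =
          HahnSeries.ofPowerSeries ℤ C (PowerSeries.mk fun n => a ^ n) := by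
        simp only [h]
        rw [map_mul, HahnSeries.ofPowerSeries_X, single_neg_one_mul_single_one_mul]
      rw [sub_mul, h3, h2]
      simp only [h]
      ring
    have hm : h ∈ (algebraMap (RatFunc C) C⸨X⸩).fieldRange := by
      rw [eq_inv_of_mul_eq_one_right hinv]
      refine inv_mem (sub_mem ?_ (hCm a))
      have : (HahnSeries.single (-1) 1 : C⸨X⸩) = (HahnSeries.single 1 1)⁻¹ := by
        rw [HahnSeries.inv_single, inv_one]
      rw [this]
      exact inv_mem ⟨RatFunc.X, RatFunc.coe_X⟩
    refine ⟨(theta C)^[k] h, ?_, by rw [borel_theta_iterate, hb]⟩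
    induction k with
    | zero => exact hm
    | succ k ih =>
      rw [Function.iterate_succ_apply']
      exact theta_mem_ratFunc_range ih
  · rintro _ _ ⟨r, hr, rfl⟩ ⟨r', hr', rfl⟩
    exact ⟨r + r', add_mem hr hr', map_add _ _ _⟩
  · rintro c _ ⟨r, hr, rfl⟩
    exact ⟨HahnSeries.C c * r, mul_mem (hCm c) hr, borel_C_mul c r⟩

end ExpPoly

/-! ### Embedding an archimedean valued field into ℂ. -/

section Embedding

variable {C : Type*} [NormedField C]

/-- On an archimedean field of characteristic zero, the norm of natural numbers is a power of
the usual absolute value. -/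
lemma exists_norm_natCast_eq_rpow [CharZero C] (harch : ¬ IsNonarchimedean (fun x : C => ‖x‖)) :
    ∃ s : ℝ, 0 < s ∧ ∀ n : ℕ, ‖(n : C)‖ = (n : ℝ) ^ s := by
  let v : AbsoluteValue ℚ ℝ :=
    { toFun := fun q => ‖(q : C)‖
      map_mul' := fun x y => by simp
      nonneg' := fun x => norm_nonneg _
      eq_zero' := fun x => by simp
      add_le' := fun x y => by rw [Rat.cast_add]; exact norm_add_le _ _ }
  -- A norm bounded by 1 on ℕ is ultrametric, so v is unbounded there, and Ostrowski's theorem makes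
  -- it equivalent to the usual absolute value on ℚ.
  have hv : ¬ ∀ n : ℕ, v n ≤ 1 := by
    intro h
    refine harch ?_
    have : IsUltrametricDist C :=
      IsUltrametricDist.isUltrametricDist_of_forall_norm_natCast_le_one fun n => by
        simpa [v] using h n
    exact fun x y => IsUltrametricDist.norm_add_le_max x y
  obtain ⟨c, hc, h⟩ := Rat.AbsoluteValue.exists_nat_rpow_iff_isEquiv.2
    (Rat.AbsoluteValue.equiv_real_of_unbounded hv)
  refine ⟨c⁻¹, inv_pos.2 hc, fun n => ?_⟩
  have hn := h n
  rw [Rat.AbsoluteValue.real_eq_abs, Rat.cast_abs, Rat.cast_natCast, Nat.abs_cast] at hn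
  rw [← hn, ← Real.rpow_mul (v.nonneg _), mul_inv_cancel₀ hc.ne', Real.rpow_one]
  simp [v]

/-- The root of the norm that restricts to the usual absolute value on `ℕ` satisfies the
triangle inequality. -/
lemma norm_rpow_add_le {s : ℝ} (hs : 0 < s) (h : ∀ n : ℕ, ‖(n : C)‖ = (n : ℝ) ^ s) (x y : C) :
    ‖x + y‖ ^ s⁻¹ ≤ ‖x‖ ^ s⁻¹ + ‖y‖ ^ s⁻¹ := by
  set a := ‖x‖ ^ s⁻¹ with ha
  set b := ‖y‖ ^ s⁻¹ with hb
  have ha0 : 0 ≤ a := by positivity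
  have hb0 : 0 ≤ b := by positivity
  have hxa : ‖x‖ = a ^ s := by
    rw [ha, ← Real.rpow_mul (norm_nonneg _), inv_mul_cancel₀ hs.ne', Real.rpow_one]
  have hyb : ‖y‖ = b ^ s := by
    rw [hb, ← Real.rpow_mul (norm_nonneg _), inv_mul_cancel₀ hs.ne', Real.rpow_one]
  -- Each term of the binomial expansion of (x+y)ⁿ has norm equal to the s-th power of the matching
  -- term of (a+b)ⁿ. The factor n + 1 disappears as n grows, because qⁿ outgrows n + 1 for q > 1.
  have hpow : ∀ n : ℕ, ‖x + y‖ ^ n ≤ (n + 1) * ((a + b) ^ s) ^ n := by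
    intro n
    rw [← norm_pow, add_pow]
    refine (norm_sum_le _ _).trans ?_
    have : ∀ m ∈ Finset.range (n + 1), ‖x ^ m * y ^ (n - m) * (n.choose m : C)‖ ≤
        ((a + b) ^ s) ^ n := by
      intro m hm
      rw [norm_mul, norm_mul, norm_pow, norm_pow, h, hxa, hyb, Real.rpow_pow_comm ha0,
        Real.rpow_pow_comm hb0, Real.rpow_pow_comm (add_nonneg ha0 hb0),
        ← Real.mul_rpow (by positivity) (by positivity),
        ← Real.mul_rpow (by positivity) (by positivity)]
      refine Real.rpow_le_rpow (by positivity) ?_ hs.le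
      rw [add_pow]
      exact Finset.single_le_sum (f := fun m => a ^ m * b ^ (n - m) * (n.choose m : ℝ))
        (fun i _ => by positivity) hm
    refine (Finset.sum_le_sum this).trans ?_
    simp
  have hle : ‖x + y‖ ≤ (a + b) ^ s := by
    by_contra! hlt
    have h0 : 0 ≤ (a + b) ^ s := by positivity
    rcases h0.eq_or_lt with h0 | h0
    · have := hpow 1
      rw [← h0] at this hlt
      simp at this
      simp [this] at hlt
    · set q := ‖x + y‖ / (a + b) ^ s with hq
      have hq1 : 1 < q := (one_lt_div h0).2 hlt
      have hqn : ∀ n : ℕ, q ^ n ≤ n + 1 := by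
        intro n
        rw [hq, div_pow, div_le_iff₀ (by positivity)]
        exact hpow n
      have hlim := tendsto_pow_const_div_const_pow_of_one_lt 1 hq1
      have hlim' := hlim.add (tendsto_pow_const_div_const_pow_of_one_lt 0 hq1)
      rw [add_zero] at hlim'
      obtain ⟨n, hn⟩ := (hlim'.eventually (gt_mem_nhds one_pos)).exists
      rw [← add_div, div_lt_one (by positivity)] at hn
      have := hqn n
      simp at hn
      linarith
  calc ‖x + y‖ ^ s⁻¹ ≤ ((a + b) ^ s) ^ s⁻¹ :=
        Real.rpow_le_rpow (norm_nonneg _) hle (inv_pos.2 hs).le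
    _ = a + b := by
        rw [← Real.rpow_mul (by positivity), mul_inv_cancel₀ hs.ne', Real.rpow_one]

/-- A complete normed field in which the natural numbers have their usual absolute value embeds
continuously into `ℂ`. -/
lemma exists_ringHom_complex_of_complete {F : Type*} [NormedField F] [CompleteSpace F]
    (h : ∀ n : ℕ, ‖(n : F)‖ = n) :
    ∃ (φ : F →+* ℂ) (A : ℝ), ∀ x, ‖φ x‖ ≤ A * ‖x‖ := by
  have hch : CharZero F := by
    refine charZero_of_inj_zero fun n hn => ?_
    have := h n
    rw [hn, norm_zero] at this
    exact_mod_cast this.symm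
  have hint : ∀ n : ℤ, ‖(n : F)‖ = |(n : ℝ)| := by
    intro n
    obtain ⟨m, rfl | rfl⟩ := n.eq_nat_or_neg <;> simp [h]
  have hrat : ∀ q : ℚ, ‖(q : F)‖ = ‖q‖ := by
    intro q
    rw [Rat.cast_def, norm_div, hint, h, ← Rat.norm_cast_real, Real.norm_eq_abs, Rat.cast_def,
      abs_div, Nat.abs_cast]
  have hiso : Isometry (Rat.castHom F) :=
    AddMonoidHomClass.isometry_of_norm _ hrat
  let ψ : ℝ →+* F := IsDenseInducing.extendRingHom (i := Rat.castHom ℝ) (f := Rat.castHom F)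
    Rat.isUniformEmbedding_coe_real.isUniformInducing
    Rat.isDenseEmbedding_coe_real.dense hiso.uniformContinuous
  have hψc : Continuous ψ := uniformContinuous_uniformly_extend
    Rat.isUniformEmbedding_coe_real.isUniformInducing
    Rat.isDenseEmbedding_coe_real.dense hiso.uniformContinuous |>.continuous
  have hψn : ∀ x : ℝ, ‖ψ x‖ = ‖x‖ := by
    refine fun x => congrFun (Rat.isDenseEmbedding_coe_real.dense.equalizer
      (hψc.norm) continuous_norm ?_) x
    funext q
    simp [hrat, ← Rat.norm_cast_real]
  let _ : NormedAlgebra ℝ F :=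
    { ψ.toAlgebra with
      norm_smul_le := fun r x => by
        change ‖ψ r * x‖ ≤ _
        rw [norm_mul, hψn] }
  -- By Gelfand–Mazur, F is ℝ or ℂ as an algebra. Finite dimension makes the isomorphism continuous,
  -- and its operator norm is the constant A.
  rcases NormedAlgebra.Real.nonempty_algEquiv_or F with ⟨⟨e⟩⟩ | ⟨⟨e⟩⟩
  · have : FiniteDimensional ℝ F := e.symm.toLinearEquiv.finiteDimensional
    let e' : F →L[ℝ] ℝ := LinearMap.toContinuousLinearMap e.toLinearMap
    refine ⟨Complex.ofRealHom.comp (e : F →+* ℝ), ‖e'‖, fun x => ?_⟩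
    have := e'.le_opNorm x
    simpa [e'] using this
  · have : FiniteDimensional ℝ F := e.symm.toLinearEquiv.finiteDimensional
    let e' : F →L[ℝ] ℂ := LinearMap.toContinuousLinearMap e.toLinearMap
    exact ⟨(e : F →+* ℂ), ‖e'‖, fun x => e'.le_opNorm x⟩

/-- A field of characteristic zero with an archimedean absolute value embeds into `ℂ`, with
control of the absolute values. -/
theorem exists_ringHom_complex [CharZero C] (harch : ¬ IsNonarchimedean (fun x : C => ‖x‖)) :
    ∃ (φ : C →+* ℂ) (A s : ℝ), 0 ≤ A ∧ 0 < s ∧ ∀ x, ‖φ x‖ ≤ A * ‖x‖ ^ s := by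
  obtain ⟨s, hs, h⟩ := exists_norm_natCast_eq_rpow harch
  -- Taking the s-th root normalises the absolute value to be the usual one on ℕ, as the complete
  -- case requires.
  let v : AbsoluteValue C ℝ :=
    { toFun := fun x => ‖x‖ ^ s⁻¹
      map_mul' := fun x y => by
        rw [norm_mul, Real.mul_rpow (norm_nonneg _) (norm_nonneg _)]
      nonneg' := fun x => by positivity
      eq_zero' := fun x => by
        rw [Real.rpow_eq_zero (norm_nonneg _) (inv_pos.2 hs).ne', norm_eq_zero]
      add_le' := norm_rpow_add_le hs h }
  let ι : C →+* v.Completion :=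
    (UniformSpace.Completion.coeRingHom (α := WithAbs v)).comp
      (WithAbs.equiv v).symm.toRingHom
  have hι : ∀ x, ‖ι x‖ = ‖x‖ ^ s⁻¹ := fun x =>
    (UniformSpace.Completion.norm_coe (WithAbs.toAbs v x)).trans rfl
  obtain ⟨φ, A, hφ⟩ := exists_ringHom_complex_of_complete (F := v.Completion) fun n => by
    rw [← map_natCast ι, hι, h, ← Real.rpow_mul n.cast_nonneg, mul_inv_cancel₀ hs.ne',
      Real.rpow_one]
  refine ⟨φ.comp ι, |A|, s⁻¹, abs_nonneg _, inv_pos.2 hs, fun x => ?_⟩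
  rw [← hι]
  exact (hφ _).trans (mul_le_mul_of_nonneg_right (le_abs_self A) (norm_nonneg _))

end Embedding

/-! ### Independence of the sequences q(n)ζⁿ. -/

section ExponentialSums

variable {K : Type*} [Field K]

variable (K) in
/-- The shift operator on sequences. -/
def shift : Module.End K (ℕ → K) where
  toFun s n := s (n + 1)
  map_add' _ _ := rfl
  map_smul' _ _ := rfl

lemma shift_apply (s : ℕ → K) (n : ℕ) : shift K s n = s (n + 1) := rfl

/-- With T = shift - μ, one has T(n·s) = n·T(s) + shift(s), and T commutes with the shift.
Multiplication by n therefore costs just one more power of T. -/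
lemma pow_shift_sub_natCast_mul (μ : K) (k : ℕ) :
    ∀ s : ℕ → K, ((shift K - μ • (1 : Module.End K (ℕ → K))) ^ k) s = 0 →
      ((shift K - μ • (1 : Module.End K (ℕ → K))) ^ (k + 1)) (fun n => (n : K) * s n) = 0 := by
  set T := shift K - μ • (1 : Module.End K (ℕ → K)) with hT
  have hcomm : Commute T (shift K) :=
    (Commute.refl (shift K)).sub_left ((Commute.one_left _).smul_left μ)
  have hTM : ∀ s : ℕ → K, T (fun n => (n : K) * s n) =
      (fun n : ℕ => (n : K) * T s n) + shift K s := by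
    intro s
    funext n
    simp only [hT, LinearMap.sub_apply, LinearMap.smul_apply, Module.End.one_apply, Pi.sub_apply,
      Pi.smul_apply, Pi.add_apply, shift_apply, smul_eq_mul]
    push_cast
    ring
  induction k with
  | zero =>
    intro s hs
    have : s = 0 := hs
    subst this
    simp [← Pi.zero_def]
  | succ k ih =>
    intro s hs
    rw [pow_succ, Module.End.mul_apply, hTM, map_add, ih (T s)
      (by rw [pow_succ, Module.End.mul_apply] at hs; exact hs), zero_add,
      ← Module.End.mul_apply, (hcomm.pow_left (k + 1)).eq, Module.End.mul_apply, hs, map_zero]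

lemma eval_mul_pow_mem_maxGenEigenspace (q : Polynomial K) (μ : K) :
    (fun n : ℕ => q.eval (n : K) * μ ^ n) ∈ (shift K).maxGenEigenspace μ := by
  induction q using Polynomial.induction_on with
  | C a =>
    rw [Module.End.mem_maxGenEigenspace]
    refine ⟨1, ?_⟩
    funext n
    simp only [pow_one, LinearMap.sub_apply, LinearMap.smul_apply, Module.End.one_apply,
      Pi.sub_apply, Pi.smul_apply, shift_apply, smul_eq_mul, Polynomial.eval_C, Pi.zero_apply]
    ring
  | add p q hp hq =>
    convert add_mem hp hq using 1
    funext n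
    simp [add_mul]
  | monomial m a h =>
    rw [Module.End.mem_maxGenEigenspace] at h ⊢
    obtain ⟨k, hk⟩ := h
    refine ⟨k + 1, ?_⟩
    convert pow_shift_sub_natCast_mul μ k _ hk using 2
    funext n
    simp only [Polynomial.eval_mul, Polynomial.eval_C, Polynomial.eval_pow, Polynomial.eval_X]
    ring

/-- An exponential polynomial vanishing at all natural numbers is trivial. -/
lemma sum_filter_eq_zero [CharZero K] [DecidableEq K] {ι : Type*} (S : Finset ι)
    (q : ι → Polynomial K) (z : ι → K) (hz : ∀ i, z i ≠ 0)
    (h : ∀ n : ℕ, ∑ i ∈ S, (q i).eval (n : K) * z i ^ n = 0) (ζ : K) :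
    ∑ i ∈ S with z i = ζ, q i = 0 := by
  by_cases hζ : ζ ∈ S.image z
  swap
  · refine (Finset.sum_congr (Finset.filter_eq_empty_iff.2 fun i hi hiz => hζ ?_)
      fun _ _ => rfl).trans Finset.sum_empty
    exact Finset.mem_image.2 ⟨i, hi, hiz⟩
  set Q : K → Polynomial K := fun ζ => ∑ i ∈ S with z i = ζ, q i
  have hsum : ∑ ζ ∈ S.image z, (fun n : ℕ => (Q ζ).eval (n : K) * ζ ^ n) = 0 := by
    funext n
    rw [Finset.sum_apply, Pi.zero_apply, ← h n,
      ← Finset.sum_fiberwise_of_maps_to (fun i hi => Finset.mem_image_of_mem z hi)]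
    refine Finset.sum_congr rfl fun ζ _ => ?_
    simp only [Q]
    rw [Polynomial.eval_finsetSum, Finset.sum_mul]
    refine Finset.sum_congr rfl fun i hi => ?_
    rw [(Finset.mem_filter.1 hi).2]
  -- After grouping by ζ, the summands lie in generalised eigenspaces of the shift for distinct
  -- eigenvalues, so each one vanishes.
  have hind := (iSupIndep_iff_finsetSum_eq_zero_imp_eq_zero _).1
    (shift K).independent_maxGenEigenspace (S.image z)
    (fun ζ n => (Q ζ).eval (n : K) * ζ ^ n)
    (fun ζ _ => eval_mul_pow_mem_maxGenEigenspace (Q ζ) ζ) hsum ζ hζ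
  have hζ0 : ζ ≠ 0 := by
    obtain ⟨i, _, rfl⟩ := Finset.mem_image.1 hζ
    exact hz i
  refine Polynomial.eq_zero_of_infinite_isRoot _
    ((Set.infinite_range_of_injective (Nat.cast_injective (R := K))).mono ?_)
  rintro _ ⟨n, rfl⟩
  exact (mul_eq_zero.1 (congrFun hind n)).resolve_right (pow_ne_zero _ hζ0)

end ExponentialSums

/-! ### Evaluation of complex power series at points of absolute convergence. -/

section Eval

/-- The power series `p` converges absolutely at `z`, with sum `v`. -/
def HasEval (p : ℂ⟦X⟧) (z v : ℂ) : Prop :=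
  (Summable fun n => ‖PowerSeries.coeff n p * z ^ n‖) ∧
    HasSum (fun n => PowerSeries.coeff n p * z ^ n) v

lemma HasEval.unique {p : ℂ⟦X⟧} {z v w : ℂ} (h : HasEval p z v) (h' : HasEval p z w) : v = w :=
  h.2.unique h'.2

lemma HasEval.add {p q : ℂ⟦X⟧} {z v w : ℂ} (hp : HasEval p z v) (hq : HasEval q z w) :
    HasEval (p + q) z (v + w) := by
  refine ⟨(hp.1.add hq.1).of_nonneg_of_le (fun _ => norm_nonneg _) fun n => ?_, ?_⟩
  · rw [map_add, add_mul]
    exact norm_add_le _ _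
  · simpa only [map_add, add_mul] using hp.2.add hq.2

lemma HasEval.mul {p q : ℂ⟦X⟧} {z v w : ℂ} (hp : HasEval p z v) (hq : HasEval q z w) :
    HasEval (p * q) z (v * w) := by
  have hterm : (fun n => PowerSeries.coeff n (p * q) * z ^ n) = fun n =>
      ∑ x ∈ Finset.HasAntidiagonal.antidiagonal n, (PowerSeries.coeff x.1 p * z ^ x.1) *
        (PowerSeries.coeff x.2 q * z ^ x.2) := by
    funext n
    rw [PowerSeries.coeff_mul, Finset.sum_mul]
    refine Finset.sum_congr rfl fun x hx => ?_
    rw [← Finset.HasAntidiagonal.mem_antidiagonal.1 hx, pow_add]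
    ring
  have hs := summable_norm_sum_mul_antidiagonal_of_summable_norm hp.1 hq.1
  refine ⟨?_, ?_⟩
  · exact hs.congr fun n => by rw [← congrFun hterm n]
  · rw [hterm, ← hp.2.tsum_eq, ← hq.2.tsum_eq,
      tsum_mul_tsum_eq_tsum_sum_antidiagonal_of_summable_norm hp.1 hq.1]
    exact hs.of_norm.hasSum

lemma hasEval_polynomial (q : Polynomial ℂ) (z : ℂ) : HasEval (q : ℂ⟦X⟧) z (q.eval z) := by
  have h0 : ∀ n ∉ Finset.range (q.natDegree + 1), q.coeff n * z ^ n = 0 := by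
    intro n hn
    rw [Polynomial.coeff_eq_zero_of_natDegree_lt (by simpa using hn), zero_mul]
  simp only [HasEval, Polynomial.coeff_coe]
  refine ⟨summable_of_ne_finset_zero fun n hn => by rw [h0 n hn, norm_zero], ?_⟩
  rw [Polynomial.eval_eq_sum_range]
  exact hasSum_sum_of_ne_finset_zero h0

lemma hasEval_expSeries (a z : ℂ) : HasEval (expSeries a) z (Complex.exp (a * z)) := by
  have : (fun n => PowerSeries.coeff n (expSeries a) * z ^ n) =
      fun n : ℕ => (a * z) ^ n / (n.factorial : ℂ) := by
    funext n
    rw [coeff_expSeries, mul_pow]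
    ring
  have h1 := NormedSpace.norm_expSeries_div_summable (a * z)
  have h2 := NormedSpace.expSeries_div_hasSum_exp (a * z)
  rw [← Complex.exp_eq_exp_ℂ] at h2
  rw [← this] at h2
  refine ⟨h1.congr fun n => ?_, h2⟩
  rw [← congrFun this n]

lemma HasEval.sum {ι : Type*} (S : Finset ι) {p : ι → ℂ⟦X⟧} {z : ℂ} {v : ι → ℂ}
    (h : ∀ i ∈ S, HasEval (p i) z (v i)) : HasEval (∑ i ∈ S, p i) z (∑ i ∈ S, v i) := by
  classical
  induction S using Finset.induction_on with
  | empty => simpa using hasEval_polynomial 0 z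
  | insert i S hi ih =>
    rw [Finset.sum_insert hi, Finset.sum_insert hi]
    exact (h i (Finset.mem_insert_self i S)).add (ih fun j hj => h j (Finset.mem_insert_of_mem hj))

end Eval

/-! ### Division of exponential polynomials by exp(-z) - 1. -/

section Division

variable {C : Type*} [Field C] [CharZero C]

lemma map_expSeries (φ : C →+* ℂ) (a : C) :
    PowerSeries.map φ (expSeries a) = expSeries (φ a) := by
  ext n
  rw [PowerSeries.coeff_map, coeff_expSeries, coeff_expSeries]
  simp

/-- Telescoping exp((b-1)z) - exp(bz) = (exp(-z) - 1)exp(bz): exponentials whose exponents differ by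
an integer agree modulo exp(-z) - 1. -/
lemma exists_polynomial_mul_sub_eq (q : Polynomial C) (a : C) (n : ℤ) :
    ∃ s ∈ expPoly C, (q : C⟦X⟧) * (expSeries (a + n) - expSeries a) =
      (expSeries (-1) - 1) * s := by
  have hstep : ∀ b : C, ∃ s ∈ expPoly C, (q : C⟦X⟧) * (expSeries (b - 1) - expSeries b) =
      (expSeries (-1) - 1) * s := by
    intro b
    refine ⟨(q : C⟦X⟧) * expSeries b, polynomial_mul_mem q ?_, ?_⟩
    · simpa using X_pow_mul_expSeries_mem 0 b
    · rw [sub_eq_add_neg b, expSeries_add]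
      ring
  induction n using Int.induction_on with
  | zero => exact ⟨0, zero_mem _, by simp⟩
  | succ n ih =>
    obtain ⟨s, hs, h⟩ := ih
    obtain ⟨s', hs', h'⟩ := hstep (a + (n + 1))
    refine ⟨s - s', sub_mem hs hs', ?_⟩
    rw [show a + (n + 1 : C) - 1 = a + n by ring] at h'
    push_cast at h ⊢
    linear_combination h - h'
  | pred n ih =>
    obtain ⟨s, hs, h⟩ := ih
    obtain ⟨s', hs', h'⟩ := hstep (a + -n)
    refine ⟨s + s', add_mem hs hs', ?_⟩
    push_cast at h ⊢
    rw [show a + (-n - 1 : C) = a + -n - 1 by ring]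
    linear_combination h + h'

/-- If the quotient of an exponential polynomial, up to a polynomial factor, by `exp(-z) - 1` is
entire, then it is an exponential polynomial. -/
theorem exists_eq_exp_sub_one_mul (φ : C →+* ℂ) {F h : C⟦X⟧} {L : Polynomial C} (hL : L ≠ 0)
    (hF : F ∈ expPoly C) (hh : ∀ z, ∃ v, HasEval (PowerSeries.map φ h) z v)
    (heq : (expSeries (-1) - 1) * h = (L : C⟦X⟧) * F) :
    ∃ s ∈ expPoly C, F = (expSeries (-1) - 1) * s := by
  classical
  obtain ⟨p, rfl⟩ := exists_sum_eq_of_mem_expPoly hF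
  rw [Finsupp.sum] at heq ⊢
  set w : ℂ := 2 * Real.pi * Complex.I with hw
  have hw0 : w ≠ 0 := Complex.two_pi_I_ne_zero
  set z : C → ℂ := fun a => Complex.exp (φ a * w) with hz
  -- At the point wn the factor exp(-z) - 1 vanishes while h converges, so L·F has value 0 there,
  -- and exp(φ(a)wn) = z(a)ⁿ.
  have hev : ∀ n : ℕ, ∑ a ∈ p.support,
      (((L * p a).map φ).comp (Polynomial.C w * Polynomial.X)).eval (n : ℂ) * z a ^ n = 0 := by
    intro n
    obtain ⟨v, hv⟩ := hh (w * n)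
    have h1 : HasEval (PowerSeries.map φ (expSeries (-1) - 1)) (w * n) 0 := by
      have := (hasEval_expSeries (-1) (w * n)).add (hasEval_polynomial (Polynomial.C (-1)) (w * n))
      have he : Complex.exp (-1 * (w * n)) = 1 := by
        rw [Complex.exp_eq_one_iff]
        exact ⟨-n, by push_cast; ring⟩
      rw [he, Polynomial.eval_C, add_neg_cancel] at this
      convert this using 1
      rw [map_sub, map_expSeries, map_one, Polynomial.coe_C, map_neg, map_neg, map_one, map_one,
        sub_eq_add_neg]
    have h2 : HasEval (PowerSeries.map φ
        ((L : C⟦X⟧) * ∑ a ∈ p.support, (p a : C⟦X⟧) * expSeries a)) (w * n)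
        (∑ a ∈ p.support, ((L * p a).map φ).eval (w * n) * Complex.exp (φ a * (w * n))) := by
      rw [Finset.mul_sum, map_sum]
      refine HasEval.sum _ fun a _ => ?_
      rw [← mul_assoc, ← Polynomial.coe_mul, map_mul, map_expSeries, ← Polynomial.polynomial_map_coe]
      exact (hasEval_polynomial _ _).mul (hasEval_expSeries _ _)
    rw [← heq, map_mul] at h2
    have h3 := (h1.mul hv).unique h2
    rw [zero_mul] at h3
    rw [h3]
    refine Finset.sum_congr rfl fun a _ => ?_
    simp only [hz, ← Complex.exp_nat_mul, Polynomial.eval_comp, Polynomial.eval_mul,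
      Polynomial.eval_C, Polynomial.eval_X]
    congr 2
    ring
  have hzero : ∀ ζ : ℂ, ∑ a ∈ p.support with z a = ζ, p a = 0 := by
    intro ζ
    have h1 := sum_filter_eq_zero p.support _ z (fun a => Complex.exp_ne_zero _) hev ζ
    have h2 : (((L * ∑ a ∈ p.support with z a = ζ, p a).map φ).comp
        (Polynomial.C w * Polynomial.X)) = 0 := by
      rw [← h1, Finset.mul_sum, Polynomial.map_sum, Polynomial.sum_comp]
    rw [Polynomial.comp_C_mul_X_eq_zero_iff (isUnit_iff_ne_zero.2 hw0).mem_nonZeroDivisors,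
      Polynomial.map_eq_zero, mul_eq_zero] at h2
    exact h2.resolve_left hL
  -- One exponent r(ζ) is chosen in each class of exponents with the same z. Members of a class
  -- differ by integers, since 2πi divides out and φ is injective.
  have hrep : ∀ ζ : ℂ, ∃ r : C, ∀ a, z a = ζ → z r = ζ := by
    intro ζ
    by_cases h : ∃ a, z a = ζ
    · exact ⟨h.choose, fun _ _ => h.choose_spec⟩
    · exact ⟨0, fun a ha => absurd ⟨a, ha⟩ h⟩
  choose r hr using hrep
  have hint : ∀ a, ∃ n : ℤ, a = r (z a) + n := by
    intro a
    have h1 : z a = z (r (z a)) := (hr (z a) a rfl).symm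
    obtain ⟨n, hn⟩ := Complex.exp_eq_exp_iff_exists_int.1 h1
    refine ⟨n, φ.injective (mul_right_cancel₀ hw0 ?_)⟩
    rw [hn, map_add, map_intCast, add_mul]
  have hterm : ∀ a, ∃ s ∈ expPoly C, (p a : C⟦X⟧) * (expSeries a - expSeries (r (z a))) =
      (expSeries (-1) - 1) * s := by
    intro a
    obtain ⟨n, hn⟩ := hint a
    have := exists_polynomial_mul_sub_eq (p a) (r (z a)) n
    rwa [← hn] at this
  choose s hs hs' using hterm
  -- Once every exponent is replaced by its representative, the coefficients in each class add up to
  -- zero by `hzero`.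
  have hrest : ∑ a ∈ p.support, (p a : C⟦X⟧) * expSeries (r (z a)) = 0 := by
    rw [← Finset.sum_fiberwise_of_maps_to (fun a ha => Finset.mem_image_of_mem z ha)]
    refine Finset.sum_eq_zero fun ζ _ => ?_
    have : ∑ a ∈ p.support with z a = ζ, (p a : C⟦X⟧) * expSeries (r (z a)) =
        ((∑ a ∈ p.support with z a = ζ, p a : Polynomial C) : C⟦X⟧) * expSeries (r ζ) := by
      rw [← Polynomial.coeToPowerSeries.ringHom_apply, map_sum, Finset.sum_mul]
      refine Finset.sum_congr rfl fun a ha => ?_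
      rw [(Finset.mem_filter.1 ha).2]
      simp
    rw [this, hzero, Polynomial.coe_zero, zero_mul]
  refine ⟨∑ a ∈ p.support, s a, sum_mem fun a _ => hs a, ?_⟩
  rw [Finset.mul_sum, ← sub_zero (∑ a ∈ p.support, (p a : C⟦X⟧) * expSeries a), ← hrest,
    ← Finset.sum_sub_distrib]
  refine Finset.sum_congr rfl fun a _ => ?_
  rw [← hs', mul_sub]

end Division

/-! ### Growth bounds: τ preserves convergence, and Borel transforms are entire. -/

section ConvergentBounds

variable {C : Type*} [NormedField C]

lemma IsConvergent.exists_bound {g : C⸨X⸩} (hg : IsConvergent g) :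
    ∃ M R : ℝ, 0 ≤ M ∧ 0 ≤ R ∧ ∀ n : ℕ, ‖g.coeff n‖ ≤ M * R ^ n := by
  obtain ⟨r, hr, h⟩ := hg
  refine ⟨∑' n : ℕ, ‖g.coeff (n : ℤ)‖ * r ^ n, r⁻¹, tsum_nonneg fun n => by positivity,
    by positivity, fun n => ?_⟩
  rw [inv_pow, ← div_eq_mul_inv, le_div_iff₀ (by positivity)]
  exact h.le_tsum n fun m _ => by positivity

lemma isConvergent_of_bound {g : C⸨X⸩} {M R : ℝ} (hR : 0 < R)
    (h : ∀ n : ℕ, ‖g.coeff n‖ ≤ M * R ^ n) : IsConvergent g := by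
  refine ⟨(2 * R)⁻¹, by positivity, (summable_geometric_two.mul_left M).of_nonneg_of_le
    (fun n => by positivity) fun n => ?_⟩
  calc ‖g.coeff (n : ℤ)‖ * (2 * R)⁻¹ ^ n ≤ M * R ^ n * (2 * R)⁻¹ ^ n := by
        gcongr
        exact h n
    _ = M * (1 / 2) ^ n := by
        rw [mul_assoc, ← mul_pow]
        congr 2
        field_simp

lemma IsConvergent.tau [CharZero C] {g : C⸨X⸩} (hg : IsConvergent g) :
    IsConvergent (tau C g) := by
  obtain ⟨M, R, hM, hR, h⟩ := hg.exists_bound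
  -- Binomial coefficients have norm at most their value, so the bound MRⁿ becomes a binomial sum
  -- with ratio 1 + R. The extra constant covers index 0, which `coeff_tau` does not reach.
  refine isConvergent_of_bound (M := ‖(StrongDiffTranscendence.tau C g).coeff 0‖ + M * R)
    (R := 1 + R) (by positivity) fun n => ?_
  cases n with
  | zero =>
    simp only [Nat.cast_zero, pow_zero, mul_one]
    exact le_add_of_nonneg_right (by positivity)
  | succ n =>
    push_cast
    rw [coeff_tau]
    have h1 : ‖∑ x ∈ Finset.HasAntidiagonal.antidiagonal n,
        (-1) ^ x.1 * (n.choose x.1 : C) * g.coeff (x.2 + 1)‖ ≤ M * R * (1 + R) ^ n := by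
      rw [(Commute.all 1 R).add_pow', Finset.mul_sum]
      refine (norm_sum_le _ _).trans (Finset.sum_le_sum fun x _ => ?_)
      rw [norm_mul, norm_mul, norm_pow, norm_neg, norm_one, one_pow, one_mul]
      have h2 := h (x.2 + 1)
      push_cast at h2
      calc ‖(n.choose x.1 : C)‖ * ‖g.coeff (x.2 + 1)‖
          ≤ (n.choose x.1 : ℝ) * (M * R ^ (x.2 + 1)) := by
            gcongr
            simpa using Nat.norm_cast_le (α := C) (n.choose x.1)
        _ = _ := by
            rw [nsmul_eq_mul]
            ring
    refine h1.trans ?_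
    rw [pow_succ, ← mul_assoc]
    refine (mul_le_mul_of_nonneg_right (le_add_of_nonneg_left (norm_nonneg _))
      (by positivity)).trans (le_mul_of_one_le_right (by positivity) (by linarith))

lemma isConvergent_C (c : C) : IsConvergent (HahnSeries.C c) := by
  rw [← HahnSeries.ofPowerSeries_C, isConvergent_ofPowerSeries_iff]
  refine ⟨1, one_pos, summable_of_ne_finset_zero (s := {0}) fun n hn => ?_⟩
  rw [PowerSeries.coeff_C, if_neg (by simpa using hn), norm_zero, zero_mul]

lemma isConvergent_single_one : IsConvergent (HahnSeries.single 1 1 : C⸨X⸩) := by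
  simpa using isConvergent_one.single_mul (C := C) 1

lemma ratFunc_range_le_convergentLaurent :
    (algebraMap (RatFunc C) C⸨X⸩).fieldRange ≤ convergentLaurent C := by
  rintro _ ⟨r, rfl⟩
  exact algebraMap_ratFunc_mem (F := convergentLaurent C) isConvergent_C isConvergent_single_one r

/-- The Borel transform of a convergent Laurent series is entire. -/
lemma exists_hasEval_map_borel [CharZero C] {φ : C →+* ℂ} {A s : ℝ} (hA : 0 ≤ A) (hs : 0 < s)
    (hφ : ∀ x, ‖φ x‖ ≤ A * ‖x‖ ^ s) {g : C⸨X⸩} (hg : IsConvergent g) (z : ℂ) :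
    ∃ v, HasEval (PowerSeries.map φ (borel C g)) z v := by
  obtain ⟨M, R, hM, hR, h⟩ := hg.exists_bound
  have hsum : Summable fun n =>
      ‖PowerSeries.coeff n (PowerSeries.map φ (borel C g)) * z ^ n‖ := by
    refine ((Real.summable_pow_div_factorial (R ^ s * ‖z‖)).mul_left
      (A * (M * R) ^ s)).of_nonneg_of_le (fun _ => norm_nonneg _) fun n => ?_
    rw [PowerSeries.coeff_map, coeff_borel, map_div₀, map_natCast, norm_mul, norm_div, norm_pow,
      Complex.norm_natCast]
    have h1 : ‖φ (g.coeff (n + 1))‖ ≤ A * ((M * R) ^ s * (R ^ s) ^ n) := by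
      refine (hφ _).trans (mul_le_mul_of_nonneg_left ?_ hA)
      have h2 := h (n + 1)
      push_cast at h2
      refine (Real.rpow_le_rpow (norm_nonneg _) h2 hs.le).trans (le_of_eq ?_)
      rw [Real.rpow_pow_comm hR, ← Real.mul_rpow (by positivity) (by positivity)]
      congr 1
      ring
    calc ‖φ (g.coeff (n + 1))‖ / (n.factorial : ℝ) * ‖z‖ ^ n
        ≤ A * ((M * R) ^ s * (R ^ s) ^ n) / (n.factorial : ℝ) * ‖z‖ ^ n := by gcongr
      _ = _ := by
        rw [mul_pow]
        ring
  exact ⟨_, hsum, hsum.of_norm.hasSum⟩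

end ConvergentBounds

/-! ### The kernel of the Borel transform, and d/dt versus θ. -/

section Rational

variable {C : Type*} [Field C]

lemma single_mem_ratFunc_range (k : ℤ) :
    (HahnSeries.single k 1 : C⸨X⸩) ∈ (algebraMap (RatFunc C) C⸨X⸩).fieldRange :=
  ⟨RatFunc.X ^ k, by rw [map_zpow₀, RatFunc.coe_X, ← RatFunc.single_zpow]⟩

lemma mem_ratFunc_range_of_borel_eq_zero [CharZero C] {u : C⸨X⸩} (hu : borel C u = 0) :
    u ∈ (algebraMap (RatFunc C) C⸨X⸩).fieldRange := by
  rw [borel_eq_zero_iff] at hu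
  rw [← u.single_order_mul_powerSeriesPart]
  refine mul_mem (single_mem_ratFunc_range _) ?_
  -- No positive power of t occurs in u, so its power series part stops at degree -order; the + 1 is
  -- there because `trunc` is strict.
  have : u.powerSeriesPart = (PowerSeries.trunc ((-u.order).toNat + 1) u.powerSeriesPart :
      Polynomial C) := by
    ext n
    rw [Polynomial.coeff_coe, PowerSeries.coeff_trunc]
    split_ifs with h
    · rfl
    · rw [LaurentSeries.powerSeriesPart_coeff, hu _ (by omega)]
  rw [this, RatFunc.coe_coe]
  exact ⟨_, rfl⟩

lemma derivative_eq_single_mul_theta (g : C⸨X⸩) :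
    LaurentSeries.derivative C g = HahnSeries.single (-2) 1 * theta C g := by
  rw [theta_apply, ← mul_assoc, HahnSeries.single_mul_single]
  simp

/-- Iterated derivatives are triangular combinations of iterates of `t² d/dt`. -/
lemma exists_derivative_iterate_eq (w : C⸨X⸩) (i : ℕ) :
    ∃ a : ℕ → C⸨X⸩, (∀ j, a j ∈ (algebraMap (RatFunc C) C⸨X⸩).fieldRange) ∧
      (∀ j, i < j → a j = 0) ∧ a i ≠ 0 ∧ ∀ N, i < N →
        (LaurentSeries.derivative C)^[i] w = ∑ j ∈ Finset.range N, a j * (theta C)^[j] w := by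
  induction i with
  | zero =>
    refine ⟨fun j => if j = 0 then 1 else 0, fun j => ?_, fun j hj => if_neg hj.ne', by simp,
      fun N hN => ?_⟩
    · dsimp only
      split_ifs
      exacts [one_mem _, zero_mem _]
    · rw [Finset.sum_eq_single 0]
      · simp
      · intro j _ hj
        simp [hj]
      · intro h
        exact absurd (Finset.mem_range.2 hN) h
  | succ i ih =>
    obtain ⟨a, ha, ha0, hai, h⟩ := ih
    have hd : ∀ j, LaurentSeries.derivative C (a j) ∈
        (algebraMap (RatFunc C) C⸨X⸩).fieldRange := fun j => by
      rw [derivative_eq_single_mul_theta]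
      exact mul_mem (single_mem_ratFunc_range _) (theta_mem_ratFunc_range (ha j))
    -- Differentiating aⱼθʲw gives aⱼ'θʲw + t⁻²aⱼθʲ⁺¹w; the second kind of coefficient is shifted by
    -- one index.
    let b : ℕ → C⸨X⸩ := fun j => Nat.casesOn j 0 fun k => HahnSeries.single (-2) 1 * a k
    refine ⟨fun j => LaurentSeries.derivative C (a j) + b j, fun j => add_mem (hd j) ?_,
      fun j hj => ?_, ?_, fun N hN => ?_⟩
    · cases j with
      | zero => exact zero_mem _
      | succ k => exact mul_mem (single_mem_ratFunc_range _) (ha k)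
    · obtain ⟨k, rfl⟩ : ∃ k, j = k + 1 := ⟨j - 1, by omega⟩
      simp [b, ha0 (k + 1) (by omega), ha0 k (by omega)]
    · simp only [b, ha0 (i + 1) (by omega), map_zero, zero_add]
      exact mul_ne_zero (by simp) hai
    · obtain ⟨N, rfl⟩ : ∃ k, N = k + 1 := ⟨N - 1, by omega⟩
      rw [Function.iterate_succ_apply', h (N + 1) (by omega), map_sum]
      simp only [derivative_mul, add_mul, Finset.sum_add_distrib]
      rw [add_comm]
      congr 1
      rw [Finset.sum_range_succ, ha0 N (by omega), zero_mul, add_zero, Finset.sum_range_succ']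
      rw [show b 0 = 0 from rfl, zero_mul, add_zero]
      refine Finset.sum_congr rfl fun j _ => ?_
      rw [derivative_eq_single_mul_theta, Function.iterate_succ_apply']
      simp only [b]
      ring

end Rational

/-! ### Conclusion: a convergent combination of the θⁱw forces w to be rational. -/

section Main

variable {C : Type*} [NormedField C] [IsAlgClosed C] [CharZero C]

/-- If a nontrivial combination with constant coefficients of the iterates `θⁱ w` is convergent,
then `w` is rational. -/
lemma mem_ratFunc_range_of_sum_theta_iterate
    (harch : ¬ IsNonarchimedean (fun x : C => ‖x‖)) {f : RatFunc C} {w : C⸨X⸩}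
    (heq : tau C w = w + algebraMap (RatFunc C) C⸨X⸩ f) {n : ℕ} {γ : Fin n → C} (hγ : γ ≠ 0)
    (hconv : IsConvergent (∑ i, HahnSeries.C (γ i) * (theta C)^[(i : ℕ)] w)) :
    w ∈ (algebraMap (RatFunc C) C⸨X⸩).fieldRange := by
  obtain ⟨φ, A, s, hA, hs, hφ⟩ := exists_ringHom_complex harch
  set L : Polynomial C := ∑ i : Fin n, Polynomial.C (γ i) * Polynomial.X ^ (i : ℕ) with hL
  have hL0 : L ≠ 0 := by
    intro h
    refine hγ (funext fun i => ?_)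
    have := congrArg (fun p => Polynomial.coeff p i) h
    simp only [hL, Polynomial.finsetSum_coeff, Polynomial.coeff_C_mul_X_pow,
      Polynomial.coeff_zero] at this
    rw [Finset.sum_eq_single i] at this
    · simpa using this
    · intro j _ hj
      rw [if_neg fun h => hj (Fin.ext h.symm)]
    · simp
  have hborel : borel C (∑ i, HahnSeries.C (γ i) * (theta C)^[(i : ℕ)] w) =
      (L : C⟦X⟧) * borel C w := by
    rw [map_sum, hL, ← Polynomial.coeToPowerSeries.ringHom_apply, map_sum, Finset.sum_mul]
    refine Finset.sum_congr rfl fun i _ => ?_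
    rw [borel_C_mul, borel_theta_iterate, PowerSeries.smul_eq_C_mul]
    simp [mul_assoc]
  have hF : (expSeries (-1) - 1) * borel C w = borel C (algebraMap (RatFunc C) C⸨X⸩ f) := by
    have := borel_tau w
    rw [heq, map_add] at this
    linear_combination -this
  obtain ⟨u, hu, hu'⟩ := exists_eq_exp_sub_one_mul φ hL0 (borel_algebraMap_ratFunc_mem f)
    (exists_hasEval_map_borel hA hs hφ hconv) (by rw [hborel, ← hF]; ring)
  rw [← hF] at hu'
  obtain ⟨r, hr, hru⟩ := exists_borel_ratFunc_eq hu
  have hw : borel C (w - r) = 0 := by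
    rw [map_sub, hru, mul_left_cancel₀ (expSeries_sub_one_ne_zero (by simp)) hu', sub_self]
  rw [← sub_add_cancel w r]
  exact add_mem (mem_ratFunc_range_of_borel_eq_zero hw) hr

end Main

end StrongDiffTranscendence

end

open StrongDiffTranscendence in
theorem mainTheorem6 {C : Type*} [NormedField C] [IsAlgClosed C] [CharZero C]
    (harch : ¬ IsNonarchimedean (fun x : C => ‖x‖))
    (f : RatFunc C) (hf : f ≠ 0)
    (w : LaurentSeries C) (hw : w ∉ (algebraMap (RatFunc C) (LaurentSeries C)).range)
    (heq : StrongDiffTranscendence.tau C w = w + algebraMap (RatFunc C) (LaurentSeries C) f) :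
    StrongDiffTranscendence.IsDifferentiallyTranscendental
      (LaurentSeries.derivative C (V := C))
      (StrongDiffTranscendence.convergentLaurent C) w := by
  intro n P hP hP0
  have hle := ratFunc_range_le_convergentLaurent (C := C)
  choose a ha ha0 hai hsum using fun i : ℕ => exists_derivative_iterate_eq w i
  let B : Matrix (Fin (n + 1)) (Fin (n + 1)) (convergentLaurent C) :=
    fun i j => ⟨a i j, hle (ha i j)⟩
  -- The matrix expressing derivatives through θ-iterates is lower triangular with nonzero diagonal.
  have hB : B.det ≠ 0 := by
    rw [Matrix.det_of_isLowerTriangular B fun i j hij => Subtype.ext (ha0 i j hij)]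
    exact Finset.prod_ne_zero_iff.2 fun i _ h => hai i (congrArg Subtype.val h)
  obtain ⟨Q, hQ, hQ0⟩ := exists_aeval_eq_zero_of_linear
    (v := fun i : Fin (n + 1) => (theta C)^[(i : ℕ)] w) hB
    (fun i => (hsum i (n + 1) i.2).trans (Finset.sum_range _)) hP hP0
  let τK : convergentLaurent C →+* convergentLaurent C :=
    (tau C).restrict (convergentLaurent C) (convergentLaurent C) fun g hg => IsConvergent.tau hg
  have hfi : ∀ i, (theta C)^[i] (algebraMap (RatFunc C) C⸨X⸩ f) ∈ convergentLaurent C := by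
    refine fun i => hle ?_
    induction i with
    | zero => exact ⟨f, rfl⟩
    | succ i ih =>
      rw [Function.iterate_succ_apply']
      exact theta_mem_ratFunc_range ih
  have : CharZero (convergentLaurent C) := ⟨fun m k h => by
    have h1 := congrArg (fun g : convergentLaurent C => (g : C⸨X⸩).coeff 0) h
    have h2 : ∀ m : ℕ, (m : C⸨X⸩).coeff 0 = m := fun m => by
      rw [← map_natCast (HahnSeries.C : C →+* C⸨X⸩) m, HahnSeries.C_apply,
        HahnSeries.coeff_single_same]
    simpa [h2] using h1⟩
  obtain ⟨c, b, hc, hcτ, hfix⟩ := exists_linear_relation τK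
    (fun i : Fin (n + 1) => ⟨_, hfi i⟩) (τM := tau C) (fun _ => rfl)
    (v := fun i : Fin (n + 1) => (theta C)^[(i : ℕ)] w)
    (fun i => by
      rw [← theta_iterate_tau, heq, iterate_map_add]
      rfl) hQ hQ0
  -- The coefficients cᵢ and the whole combination are τ-fixed, hence constants; so Σ γᵢθⁱw is a
  -- constant minus b, which converges.
  choose γ hγ using fun i => eq_C_of_tau_eq (congrArg Subtype.val (hcτ i))
  obtain ⟨β, hβ⟩ := eq_C_of_tau_eq hfix
  refine hw (mem_ratFunc_range_of_sum_theta_iterate harch heq (γ := γ) ?_ ?_)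
  · rintro rfl
    exact hc (funext fun i => Subtype.ext ((hγ i).trans (map_zero _)))
  · have : ∑ i, HahnSeries.C (γ i) * (theta C)^[(i : ℕ)] w = HahnSeries.C β - (b : C⸨X⸩) := by
      rw [← hβ, eq_sub_iff_add_eq]
      simp only [← hγ]
      rfl
    rw [this, sub_eq_add_neg]
    exact (isConvergent_C β).add b.2.neg
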